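/- Rings are associative with $1$, a domain is a not necessarily commutative nonzero ring without zero divisors, and modules are left modules. A unary pp formula $\varphi(x)$ over a ring $R$ has the form $\exists \bar y\,(A\bar y = \bar b\,x)$ with $A$ an $m\times k$ matrix and $\bar b$ a column of length $m$ over $R$; it defines the subgroup $\varphi(M)=\{a\in M : A\bar y=\bar b\,a \text{ for some } \bar y\in M^k\}$ of every $R$-module $M$. A submodule $A\subseteq M$ is pure if $\varphi(A)=A\cap\varphi(M)$ for all unary pp formulas $\varphi$, and relatively divisible if $rA=A\cap rM$ for all $r\in R$; $R$ is an RD ring if these two notions agree for all submodules of all $R$-modules. A module is absolutely pure if it is pure in every module containing it, and pure injective if it is injective with respect to pure embeddings. The formula $\varphi$ is high if $\varphi(E)=E$ for every absolutely pure module $E$. The first Ulm submodule $\mathfrak u(M)$ is the intersection of the subgroups $\varphi(M)$, $\varphi$ high (it is a submodule). Put $\mathfrak u^0(M)=M$, $\mathfrak u^{\alpha+1}(M)=\mathfrak u(\mathfrak u^\alpha(M))$, and $\mathfrak u^\delta(M)=\bigcap_{\alpha<\delta}\mathfrak u^\alpha(M)$ for limit ordinals $\delta$; the last Ulm submodule is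 $\mathfrak u^\infty(M)=\mathfrak u^\tau(M)$, where $\tau$ is the least ordinal with $\mathfrak u^{\tau+1}(M)=\mathfrak u^\tau(M)$. Corollary. (1) Let $N$ be a pure injective module over an RD domain. Then $\mathfrak u(N)$ is injective, there is a submodule $N_r$ of $N$ with $N=\mathfrak u(N)\oplus N_r$ and $\mathfrak u(N_r)=0$, one has $\mathfrak u(N)=\mathfrak u^\infty(N)$, and $\mathfrak u(N)$ is the largest injective submodule of $N$ (it is injective and contains every injective submodule of $N$). (2) This applies to the first Weyl algebra: for every field $k$ of characteristic $0$, the algebra $k\langle x,\partial\rangle/(\partial x-x\partial-1)$ is an RD domain. -/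

import Mathlib

universe u v w

/-- A unary positive primitive formula `∃ y, A y = b x` for left `R`-modules, where `A` is an
`m × k` matrix over `R`, `b` a column of length `m` and `y` a column of `k` variables. -/
structure PPFormula (R : Type u) where
  numVars : ℕ
  numEqs : ℕ
  A : Matrix (Fin numEqs) (Fin numVars) R
  b : Fin numEqs → R

namespace PPFormula

variable {R : Type u} [Ring R]

/-- The pp subgroup `φ(M)` defined by the pp formula `φ` in the left `R`-module `M`. -/
def eval (φ : PPFormula R) (M : Type w) [AddCommGroup M] [Module R M] : AddSubgroup M where
  carrier := {x | ∃ y : Fin φ.numVars → M, ∀ i, ∑ j, φ.A i j • y j = φ.b i • x}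
  zero_mem' := ⟨0, by simp⟩
  add_mem' := by
    rintro x x' ⟨y, hy⟩ ⟨y', hy'⟩
    exact ⟨y + y', fun i => by simp [Finset.sum_add_distrib, hy, hy']⟩
  neg_mem' := by
    rintro x ⟨y, hy⟩
    exact ⟨-y, fun i => by simp [hy]⟩

/-- The formula `r⁻¹φ`, i.e. `φ(r x)`. -/
def inv (r : R) (φ : PPFormula R) : PPFormula R where
  numVars := φ.numVars
  numEqs := φ.numEqs
  A := φ.A
  b := fun i => φ.b i * r

theorem mem_eval_inv (r : R) (φ : PPFormula R) (M : Type w) [AddCommGroup M] [Module R M]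
    (x : M) : x ∈ (φ.inv r).eval M ↔ r • x ∈ φ.eval M := by
  change (∃ y : Fin φ.numVars → M, ∀ i, ∑ j, φ.A i j • y j = (φ.b i * r) • x) ↔
    (∃ y : Fin φ.numVars → M, ∀ i, ∑ j, φ.A i j • y j = φ.b i • r • x)
  simp only [mul_smul]

end PPFormula

section

variable {R : Type u} [Ring R]

/-- The submodule `A` of `M` is pure in `M`: `A ∩ φ(M) = φ(A)` for every unary pp formula `φ`
(the inclusion `φ(A) ⊆ A ∩ φ(M)` always holds). -/
def IsPureSubmodule {M : Type w} [AddCommGroup M] [Module R M] (A : Submodule R M) : Prop :=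
  ∀ (φ : PPFormula R) (a : A), (a : M) ∈ φ.eval M → a ∈ φ.eval A

/-- The submodule `A` of `M` is relatively divisible in `M`: `A ∩ rM = rA` for every `r`. -/
def IsRDSubmodule {M : Type w} [AddCommGroup M] [Module R M] (A : Submodule R M) : Prop :=
  ∀ (r : R) (a : A), (∃ m : M, r • m = a) → ∃ a' : A, r • a' = a

variable (R)

/-- An RD ring is a ring over which purity of submodules is the same as relative divisibility. -/
def IsRDRing : Prop :=
  ∀ (M : Type w) [AddCommGroup M] [Module R M] (A : Submodule R M),
    IsPureSubmodule A ↔ IsRDSubmodule A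

/-- A module is absolutely pure if it is pure in every module that contains it. -/
def IsAbsolutelyPure (E : Type w) [AddCommGroup E] [Module R E] : Prop :=
  ∀ (M : Type w) [AddCommGroup M] [Module R M] (f : E →ₗ[R] M), Function.Injective f →
    IsPureSubmodule (LinearMap.range f)

/-- A module is pure injective if it is injective with respect to pure embeddings. -/
def IsPureInjective (N : Type w) [AddCommGroup N] [Module R N] : Prop :=
  ∀ (M : Type w) [AddCommGroup M] [Module R M] (A : Submodule R M), IsPureSubmodule A →
    ∀ f : A →ₗ[R] N, ∃ g : M →ₗ[R] N, ∀ a : A, g a = f a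

variable {R}

/-- A unary pp formula `φ` is high if `φ(E) = E` for every absolutely pure module `E`. -/
def PPFormula.IsHigh (φ : PPFormula R) : Prop :=
  ∀ (E : Type w) [AddCommGroup E] [Module R E], IsAbsolutelyPure R E → φ.eval E = ⊤

theorem PPFormula.IsHigh.inv {φ : PPFormula R} (h : PPFormula.IsHigh.{u, w} φ) (r : R) :
    PPFormula.IsHigh.{u, w} (φ.inv r) := by
  intro E _ _ hE
  refine eq_top_iff.2 fun x _ => ?_
  rw [PPFormula.mem_eval_inv, h E hE]
  trivial

variable (R)

/-- The (first) Ulm submodule `u(M)`: the intersection of all high subgroups `φ(M)` of `M`. -/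
def ulm (M : Type w) [AddCommGroup M] [Module R M] : Submodule R M where
  carrier := {x | ∀ φ : PPFormula R, PPFormula.IsHigh.{u, w} φ → x ∈ φ.eval M}
  zero_mem' := fun φ _ => (φ.eval M).zero_mem
  add_mem' := fun hx hy φ hφ => (φ.eval M).add_mem (hx φ hφ) (hy φ hφ)
  smul_mem' := fun r x hx φ hφ => (φ.mem_eval_inv r M x).1 (hx _ (hφ.inv r))

/-- The Ulm sequence of `M`, all of whose terms are regarded as submodules of `M`:
`u⁰(M) = M`, `u^(α+1)(M) = u(u^α(M))`, and `u^δ(M) = ⋂_{α<δ} u^α(M)` for `δ` a limit. -/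
noncomputable def ulmSeq (M : Type w) [AddCommGroup M] [Module R M] (α : Ordinal.{w}) :
    Submodule R M :=
  Ordinal.limitRecOn α ⊤ (fun _ U => (ulm R U).map U.subtype)
    (fun δ _ ih => ⨅ β : Set.Iio δ, ih β.1 β.2)

/-- The Ulm length of `M`: the smallest `τ` with `u^(τ+1)(M) = u^τ(M)`. -/
noncomputable def ulmLength (M : Type w) [AddCommGroup M] [Module R M] : Ordinal.{w} :=
  sInf {τ | ulmSeq R M (τ + 1) = ulmSeq R M τ}

/-- The last Ulm submodule of `M`, i.e. the last term of its Ulm sequence. -/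
noncomputable def lastUlm (M : Type w) [AddCommGroup M] [Module R M] : Submodule R M :=
  ulmSeq R M (ulmLength R M)

section

variable (M : Type w) [AddCommGroup M] [Module R M]

theorem ulmSeq_zero : ulmSeq R M 0 = ⊤ := by
  simp [ulmSeq]

theorem ulmSeq_add_one (α : Ordinal.{w}) :
    ulmSeq R M (α + 1) =
      (ulm R (ulmSeq R M α)).map (ulmSeq R M α).subtype :=
  Ordinal.limitRecOn_add_one α _ _ _

theorem ulmSeq_limit {δ : Ordinal.{w}} (h : Order.IsSuccLimit δ) :
    ulmSeq R M δ = ⨅ β : Set.Iio δ, ulmSeq R M β := by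
  simp only [ulmSeq]
  rw [Ordinal.limitRecOn_limit _ _ _ _ h]

theorem ulmSeq_antitone : Antitone (ulmSeq R M) := by
  intro α β
  induction β using Ordinal.limitRecOn with
  | zero => intro h; rw [le_antisymm h zero_le]
  | add_one β ih =>
    intro h
    rcases h.lt_or_eq with h | rfl
    · refine le_trans ?_ (ih (Order.lt_succ_iff.1 h))
      rw [ulmSeq_add_one]
      exact Submodule.map_subtype_le _ _
    · exact le_rfl
  | limit δ hδ ih =>
    intro h
    rcases h.lt_or_eq with h | rfl
    · rw [ulmSeq_limit R M hδ]
      exact iInf_le (fun β : Set.Iio δ => ulmSeq R M β) ⟨α, h⟩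
    · exact le_rfl

/-- The Ulm sequence becomes stationary, so that the Ulm length is well defined. -/
theorem ulmSeq_ulmLength_add_one :
    ulmSeq R M (ulmLength R M + 1) = ulmSeq R M (ulmLength R M) := by
  have hne : {τ | ulmSeq R M (τ + 1) = ulmSeq R M τ}.Nonempty := by
    by_contra hcon
    rw [Set.not_nonempty_iff_eq_empty, Set.eq_empty_iff_forall_notMem] at hcon
    refine not_injective_of_ordinal (ulmSeq R M) fun α β hαβ => ?_
    rcases lt_trichotomy α β with h | h | h
    · exact (hcon α (le_antisymm (ulmSeq_antitone R M (Order.le_succ α))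
        (hαβ.le.trans (ulmSeq_antitone R M (Order.succ_le_of_lt h))))).elim
    · exact h
    · exact (hcon β (le_antisymm (ulmSeq_antitone R M (Order.le_succ β))
        (hαβ.ge.trans (ulmSeq_antitone R M (Order.succ_le_of_lt h))))).elim
  exact csInf_mem hne

end

end

/-- The defining relation `∂ x = x ∂ + 1` of the first Weyl algebra; the generators `0` and `1` of
the free algebra are `x` and `∂`. -/
inductive WeylRel (k : Type u) [Field k] : FreeAlgebra k (Fin 2) → FreeAlgebra k (Fin 2) → Prop
  | comm : WeylRel k (FreeAlgebra.ι k 1 * FreeAlgebra.ι k 0)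
      (FreeAlgebra.ι k 0 * FreeAlgebra.ι k 1 + 1)

/-- The first Weyl algebra `k⟨x, ∂⟩ / (∂ x - x ∂ - 1)` over the field `k`. -/
abbrev WeylAlgebra (k : Type u) [Field k] : Type u :=
  RingQuot (WeylRel k)

/-!
(1) Let `a` be an Ulm element of the pure injective module `N`, and `e` a torsion-free element of an
injective module `E`. All pp formulas satisfied by `e` are high, so `a` satisfies them too, and
hence `N` is pure in the pushout of `E` and `N` along `e ↦ a`. Pure injectivity gives a map `E → N`
with `e ↦ a`, and its image lies in `𝔲(N)`. So `𝔲(N)` is divisible, hence absolutely pure over an RD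
domain, and another use of pure injectivity makes it a retract of an injective module.

(2) The Weyl algebra is a simple Noetherian hereditary domain. Inverting the nonzero polynomials in
`x`, or those in `∂`, turns it into a principal ideal ring. A nonzero denominator `p(x)` and a
nonzero denominator `h(∂)` always generate the unit ideal: some nonzero `f(x)` kills the quotient
by them, hence so does `f'(x) = [∂, f(x)]`, and in characteristic zero this leads down to `1`. So
splittings that exist after both localizations glue. A left ideal is free over `k[x]`, and
therefore has a resolution of length one by free modules; the splittings show that it is
projective. Over a simple Noetherian hereditary domain whose opposite is of the same kind, a
finitely generated torsion module is Artinian and cyclic, and it is a direct summand of some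
`R ⧸ R b`. So a finitely generated module is the sum of a projective module and such a summand, and
maps from it lift along every surjection with relatively divisible kernel, which is to say that
the kernel is pure.
-/

namespace PPFormula

variable {R : Type u} [Ring R]

theorem map_mem_eval (φ : PPFormula R) {M : Type v} {N : Type w} [AddCommGroup M] [Module R M]
    [AddCommGroup N] [Module R N] (f : M →ₗ[R] N) {x : M} (hx : x ∈ φ.eval M) :
    f x ∈ φ.eval N := by
  obtain ⟨y, hy⟩ := hx
  exact ⟨fun j => f (y j), fun i => by rw [← map_smul, ← hy, map_sum]; simp only [map_smul]⟩

/-- The divisibility formula `r ∣ x`. -/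
def dvd (r : R) : PPFormula R where
  numVars := 1
  numEqs := 1
  A := fun _ _ => r
  b := fun _ => 1

theorem mem_eval_dvd (r : R) {M : Type w} [AddCommGroup M] [Module R M] {x : M} :
    x ∈ (dvd r).eval M ↔ ∃ y : M, r • y = x := by
  change (∃ y : Fin 1 → M, ∀ _ : Fin 1, ∑ j, r • y j = (1 : R) • x) ↔ _
  constructor
  · rintro ⟨y, hy⟩
    exact ⟨y 0, by simpa using hy 0⟩
  · rintro ⟨y, hy⟩
    exact ⟨fun _ => y, fun _ => by simpa using hy⟩

end PPFormula

section CyclicPushout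

variable {R : Type u} [Ring R] {E N : Type w} [AddCommGroup E] [Module R E] [AddCommGroup N]
  [Module R N]

variable (R) in
/-- The pushout of `E` and `N` along the maps `R → E`, `1 ↦ e` and `R → N`, `1 ↦ a`. -/
abbrev CyclicPushout (e : E) (a : N) : Type w :=
  (E × N) ⧸ Submodule.span R {((e, -a) : E × N)}

namespace CyclicPushout

variable (e : E) (a : N)

/-- The structure map of the pushout on its first factor. -/
def inl : E →ₗ[R] CyclicPushout R e a := Submodule.mkQ _ ∘ₗ LinearMap.inl R E N

/-- The structure map of the pushout on its second factor. -/
def inr : N →ₗ[R] CyclicPushout R e a := Submodule.mkQ _ ∘ₗ LinearMap.inr R E N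

theorem mk_eq_mk_iff {p q : E × N} :
    (Submodule.Quotient.mk p : CyclicPushout R e a) = Submodule.Quotient.mk q ↔
      ∃ r : R, r • e = p.1 - q.1 ∧ r • a = q.2 - p.2 := by
  rw [Submodule.Quotient.eq, Submodule.mem_span_singleton]
  refine exists_congr fun r => ?_
  rw [Prod.ext_iff]
  simp only [Prod.smul_fst, Prod.smul_snd, Prod.fst_sub, Prod.snd_sub, smul_neg, neg_eq_iff_eq_neg,
    neg_sub]

theorem inl_eq_inr : inl (R := R) e a e = inr e a a :=
  (mk_eq_mk_iff e a).2 ⟨1, by simp, by simp⟩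

variable {e}

theorem inr_injective (he : ∀ r : R, r • e = 0 → r = 0) :
    Function.Injective (inr (R := R) e a) := by
  intro n n' h
  obtain ⟨r, h_left, h_right⟩ := (mk_eq_mk_iff e a).1 h
  obtain rfl : r = 0 := he r (by simpa using h_left)
  simpa [sub_eq_zero, eq_comm] using h_right

/-- A solution of `φ(n)` in the pushout is a solution in `E × N` up to errors `r i • (e, -a)`. The
`E`-component says that `e` satisfies `∃ y, A y = r x`, hence so does `a`, and that solution
corrects the `N`-component. -/
theorem isPureSubmodule_range_inr
    (ha : ∀ φ : PPFormula R, e ∈ φ.eval E → a ∈ φ.eval N) :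
    IsPureSubmodule (LinearMap.range (inr (R := R) e a)) := by
  rintro φ ⟨_, n, rfl⟩ ⟨y, hy⟩
  choose z hz using fun j => Submodule.Quotient.mk_surjective _ (y j)
  have errors : ∀ i, ∃ r : R, r • e = ∑ j, φ.A i j • (z j).1 ∧
      r • a = φ.b i • n - ∑ j, φ.A i j • (z j).2 := by
    intro i
    have hi := hy i
    simp only [← hz] at hi
    have hmk : (Submodule.Quotient.mk (∑ j, φ.A i j • z j) : CyclicPushout R e a) =
        Submodule.Quotient.mk (φ.b i • ((0, n) : E × N)) := by
      rw [← Submodule.mkQ_apply, map_sum]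
      simp only [map_smul]
      exact hi
    simpa [Prod.fst_sum, Prod.snd_sum] using (mk_eq_mk_iff e a).1 hmk
  choose r hr_left hr_right using errors
  obtain ⟨m, hm⟩ : a ∈ (PPFormula.mk φ.numVars φ.numEqs φ.A r).eval N :=
    ha _ ⟨fun j => (z j).1, fun i => (hr_left i).symm⟩
  refine φ.map_mem_eval (inr (R := R) e a).rangeRestrict ⟨fun j => m j + (z j).2, fun i => ?_⟩
  simp only [smul_add, Finset.sum_add_distrib]
  rw [show ∑ j, φ.A i j • m j = r i • a from hm i, hr_right, sub_add_cancel]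

end CyclicPushout

end CyclicPushout

section AbsolutelyPure

variable {R : Type u} [Ring R]

theorem IsAbsolutelyPure.mem_eval_of_injective {E M : Type w} [AddCommGroup E] [Module R E]
    [AddCommGroup M] [Module R M] (hE : IsAbsolutelyPure R E) {f : E →ₗ[R] M}
    (hf : Function.Injective f) (φ : PPFormula R) {x : E} (hx : f x ∈ φ.eval M) :
    x ∈ φ.eval E := by
  have := φ.map_mem_eval (LinearEquiv.ofInjective f hf).symm.toLinearMap
    (hE M f hf φ (LinearEquiv.ofInjective f hf x) hx)
  simpa using this

theorem IsAbsolutelyPure.of_injective {E : Type w} [AddCommGroup E] [Module R E]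
    (hE : Module.Injective R E) : IsAbsolutelyPure R E := by
  rintro M _ _ f hf φ ⟨_, x, rfl⟩ h
  obtain ⟨g, hg⟩ := hE.out f hf LinearMap.id
  have hx : g (f x) ∈ φ.eval E := φ.map_mem_eval g h
  rw [hg, LinearMap.id_apply] at hx
  exact φ.map_mem_eval f.rangeRestrict hx

theorem IsAbsolutelyPure.of_divisible (hR : IsRDRing.{u, w} R) {E : Type w} [AddCommGroup E]
    [Module R E] (hE : ∀ r : R, r ≠ 0 → ∀ e : E, ∃ e' : E, r • e' = e) :
    IsAbsolutelyPure R E := by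
  refine fun M _ _ f _ => (hR M _).2 ?_
  rintro r ⟨_, x, rfl⟩ ⟨m, hm⟩
  by_cases hr : r = 0
  · subst hr
    exact ⟨0, Subtype.ext (by simpa using hm)⟩
  · obtain ⟨x', rfl⟩ := hE r hr x
    exact ⟨f.rangeRestrict x', by ext; simp⟩

theorem exists_injective_embedding (M : Type (max u v)) [AddCommGroup M] [Module R M] :
    ∃ (E : Type (max u v)) (_ : AddCommGroup E) (_ : Module R E) (f : M →ₗ[R] E),
      Module.Injective R E ∧ Function.Injective f := by
  obtain ⟨⟨J, hJ, f, hf⟩⟩ := (ModuleCat.enoughInjectives.{v} R).presentation (ModuleCat.of R M)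
  exact ⟨J, inferInstance, inferInstance, f.hom, Module.injective_module_of_injective_object R J,
    (ModuleCat.mono_iff_injective f).1 hf⟩

/-- The map `R r → E`, `s r ↦ s e` extends to `R`, and the image of `1` is the quotient of `e` by
`r`. -/
theorem exists_smul_eq_of_injective {E : Type (max u v)} [AddCommGroup E] [Module R E]
    (hE : Module.Injective R E) {r : R} (hr : IsRightRegular r) (e : E) :
    ∃ e' : E, r • e' = e := by
  let toR : ULift.{v} R ≃ₗ[R] R := ULift.moduleEquiv
  let mulRight : ULift.{v} R →ₗ[R] ULift.{v} R :=
    toR.symm.toLinearMap ∘ₗ LinearMap.toSpanSingleton R R r ∘ₗ toR.toLinearMap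
  have mulRight_injective : Function.Injective mulRight := fun s t h =>
    toR.injective (hr (by simpa [mulRight] using h))
  obtain ⟨h, hh⟩ := hE.out mulRight mulRight_injective
    (LinearMap.toSpanSingleton R E e ∘ₗ toR.toLinearMap)
  refine ⟨h (toR.symm 1), ?_⟩
  rw [← map_smul, ← map_smul, smul_eq_mul, mul_one]
  simpa [mulRight] using hh (toR.symm 1)

end AbsolutelyPure

section Ulm

variable {R : Type u} [Ring R]

theorem map_mem_ulm {M N : Type w} [AddCommGroup M] [Module R M] [AddCommGroup N] [Module R N]
    (f : M →ₗ[R] N) {x : M} (hx : x ∈ ulm R M) : f x ∈ ulm R N :=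
  fun φ hφ => φ.map_mem_eval f (hx φ hφ)

theorem IsAbsolutelyPure.ulm_eq_top {E : Type w} [AddCommGroup E] [Module R E]
    (hE : IsAbsolutelyPure R E) : ulm R E = ⊤ :=
  eq_top_iff.2 fun x _ φ hφ => by rw [hφ E hE]; trivial

theorem IsAbsolutelyPure.map_mem_ulm {E N : Type w} [AddCommGroup E] [Module R E]
    [AddCommGroup N] [Module R N] (hE : IsAbsolutelyPure R E) (f : E →ₗ[R] N) (x : E) :
    f x ∈ ulm R N :=
  _root_.map_mem_ulm f (hE.ulm_eq_top ▸ Submodule.mem_top)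

theorem IsAbsolutelyPure.le_ulm {N : Type w} [AddCommGroup N] [Module R N] {U : Submodule R N}
    (hU : IsAbsolutelyPure R U) : U ≤ ulm R N :=
  fun x hx => hU.map_mem_ulm U.subtype ⟨x, hx⟩

theorem ulmSeq_one (M : Type w) [AddCommGroup M] [Module R M] : ulmSeq R M 1 = ulm R M := by
  rw [← zero_add 1, ulmSeq_add_one, ulmSeq_zero]
  refine le_antisymm (Submodule.map_le_iff_le_comap.2 fun x hx => map_mem_ulm _ hx) fun x hx => ?_
  exact ⟨⟨x, trivial⟩, map_mem_ulm (Submodule.topEquiv (R := R) (M := M)).symm.toLinearMap hx, rfl⟩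

theorem ulm_eq_lastUlm {M : Type w} [AddCommGroup M] [Module R M]
    (hM : IsAbsolutelyPure R (ulm R M)) : ulm R M = lastUlm R M := by
  have stationary : ulmSeq R M (1 + 1) = ulmSeq R M 1 := by
    rw [ulmSeq_add_one, ulmSeq_one, hM.ulm_eq_top, Submodule.map_top, Submodule.range_subtype]
  have length_le : ulmLength R M ≤ 1 := csInf_le' stationary
  refine le_antisymm ?_ ?_
  · exact ulmSeq_one (R := R) M ▸ ulmSeq_antitone R M length_le
  · rw [lastUlm, ← ulmSeq_ulmLength_add_one, ← ulmSeq_one]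
    exact ulmSeq_antitone R M le_add_self

theorem exists_isCompl_ulm_eq_bot {M : Type w} [AddCommGroup M] [Module R M]
    (hM : Module.Injective R (ulm R M)) :
    ∃ K : Submodule R M, IsCompl (ulm R M) K ∧ ulm R K = ⊥ := by
  obtain ⟨g, hg⟩ := hM.out (ulm R M).subtype (ulm R M).injective_subtype LinearMap.id
  have hcompl : IsCompl (ulm R M) (LinearMap.ker g) := LinearMap.isCompl_of_proj hg
  refine ⟨LinearMap.ker g, hcompl, (Submodule.eq_bot_iff _).2 fun x hx => Subtype.ext ?_⟩
  exact Submodule.disjoint_def.1 hcompl.disjoint x (map_mem_ulm (LinearMap.ker g).subtype hx) x.2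

end Ulm

section PureInjective

variable {R : Type u} [Ring R]

theorem PPFormula.isHigh_of_mem_eval {E : Type w} [AddCommGroup E] [Module R E] {e : E}
    (he : ∀ r : R, r • e = 0 → r = 0) {φ : PPFormula R} (h : e ∈ φ.eval E) :
    PPFormula.IsHigh.{u, w} φ := by
  intro D _ _ hD
  refine eq_top_iff.2 fun d _ => ?_
  refine hD.mem_eval_of_injective (CyclicPushout.inr_injective d he) φ ?_
  rw [← CyclicPushout.inl_eq_inr]
  exact φ.map_mem_eval _ h

/-- All pp formulas satisfied by the torsion-free element `e` are high, so the Ulm element `a`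
satisfies them too and the pushout of `E` and `N` along `e ↦ a` contains `N` as a pure submodule. -/
theorem exists_apply_eq_of_mem_ulm {N : Type w} [AddCommGroup N] [Module R N]
    (hN : IsPureInjective R N) {E : Type w} [AddCommGroup E] [Module R E] {e : E}
    (he : ∀ r : R, r • e = 0 → r = 0) {a : N} (ha : a ∈ ulm R N) : ∃ f : E →ₗ[R] N, f e = a := by
  have hinj := CyclicPushout.inr_injective (R := R) a he
  obtain ⟨g, hg⟩ := hN _ _ (CyclicPushout.isPureSubmodule_range_inr (R := R) (e := e) a
    fun φ hφ => ha φ (φ.isHigh_of_mem_eval he hφ)) (LinearEquiv.ofInjective _ hinj).symm.toLinearMap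
  refine ⟨g ∘ₗ CyclicPushout.inl e a, ?_⟩
  rw [LinearMap.comp_apply, CyclicPushout.inl_eq_inr]
  simpa using hg (LinearEquiv.ofInjective _ hinj a)

theorem isAbsolutelyPure_ulm [IsDomain R] (hR : IsRDRing.{u, max u v} R) {N : Type (max u v)}
    [AddCommGroup N] [Module R N] (hN : IsPureInjective R N) :
    IsAbsolutelyPure R (ulm R N) := by
  refine .of_divisible hR fun r hr ⟨a, ha⟩ => ?_
  obtain ⟨E, _, _, f, hE, hf⟩ := exists_injective_embedding.{u, v} (R := R) (ULift.{v} R)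
  have torsionFree : ∀ r : R, r • f (ULift.up 1) = 0 → r = 0 := by
    intro r h
    rw [← map_smul, map_eq_zero_iff f hf] at h
    simpa using congrArg ULift.down h
  obtain ⟨g, rfl⟩ := exists_apply_eq_of_mem_ulm hN torsionFree ha
  obtain ⟨e', he'⟩ :=
    exists_smul_eq_of_injective hE (IsRegular.of_ne_zero hr).right (f (ULift.up 1))
  exact ⟨⟨g e', (IsAbsolutelyPure.of_injective hE).map_mem_ulm g e'⟩,
    Subtype.ext (by simp [← he'])⟩

/-- The inclusion of `ulm R N` extends to a map from an injective module containing it, whose image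
lies again in `ulm R N`. -/
theorem injective_ulm {N : Type (max u v)} [AddCommGroup N] [Module R N] (hN : IsPureInjective R N)
    (hpure : IsAbsolutelyPure R (ulm R N)) : Module.Injective R (ulm R N) := by
  obtain ⟨E, _, _, f, hE, hf⟩ := exists_injective_embedding.{u, v} (R := R) (ulm R N)
  obtain ⟨g, hg⟩ := hN E _ (hpure E f hf)
    ((ulm R N).subtype ∘ₗ (LinearEquiv.ofInjective f hf).symm.toLinearMap)
  let retraction : E →ₗ[R] ulm R N :=
    g.codRestrict _ ((IsAbsolutelyPure.of_injective hE).map_mem_ulm g)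
  have retraction_apply (x : ulm R N) : retraction (f x) = x :=
    Subtype.ext (show g (f x) = x by simpa using hg (LinearEquiv.ofInjective f hf x))
  refine ⟨fun X Y _ _ _ _ i hi h => ?_⟩
  obtain ⟨k, hk⟩ := hE.out i hi (f ∘ₗ h)
  exact ⟨retraction ∘ₗ k, fun x => by simp [hk, retraction_apply]⟩

end PureInjective

section Ore

open scoped nonZeroDivisors

variable {R : Type u} [Ring R] [IsDomain R]

theorem exists_common_left_multiple [StrongRankCondition R] (a : R) {b : R} (hb : b ≠ 0) :
    ∃ u v : R, u ≠ 0 ∧ u * a = v * b := by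
  obtain ⟨v, u, h⟩ := OreLocalization.nonempty_oreSet_iff_of_noZeroDivisors.1
    (nonempty_oreSet_of_strongRankCondition (R := R)) a ⟨b, mem_nonZeroDivisors_of_ne_zero hb⟩
  exact ⟨u, v, nonZeroDivisors.ne_zero u.2, h⟩

theorem exists_common_right_multiple [StrongRankCondition Rᵐᵒᵖ] (a : R) {b : R} (hb : b ≠ 0) :
    ∃ u v : R, u ≠ 0 ∧ a * u = b * v := by
  obtain ⟨u, v, hu, h⟩ := exists_common_left_multiple (MulOpposite.op a)
    (b := MulOpposite.op b) (by simpa using hb)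
  exact ⟨u.unop, v.unop, by simpa using hu, by simpa using congrArg MulOpposite.unop h⟩

theorem linearMap_eq_of_apply_eq [StrongRankCondition R] {I : Ideal R} {M : Type v}
    [AddCommGroup M] [Module R M] [Module.IsTorsionFree R M] {f g : I →ₗ[R] M} {i : I} (hi : i ≠ 0)
    (h : f i = g i) : f = g := by
  ext j
  obtain ⟨u, v, hu, huv⟩ := exists_common_left_multiple (j : R) (b := i) (by simpa using hi)
  have hji : u • j = v • i := Subtype.ext huv
  refine smul_right_injective M hu ?_
  simp only [← map_smul, hji]
  simp only [map_smul, h]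

theorem exists_apply_mul_eq_mul [StrongRankCondition R] [StrongRankCondition Rᵐᵒᵖ] {I : Ideal R}
    (q : I →ₗ[R] R) : ∃ d w : R, d ≠ 0 ∧ ∀ i : I, q i * d = i * w := by
  by_cases! hI : ∀ i : I, i = 0
  · exact ⟨1, 0, one_ne_zero, fun i => by simp [hI i]⟩
  obtain ⟨i, hi⟩ := hI
  obtain ⟨d, w, hd, h⟩ := exists_common_right_multiple (q i) (b := i) (by simpa using hi)
  refine ⟨d, w, hd, fun j => ?_⟩
  exact LinearMap.congr_fun (linearMap_eq_of_apply_eq (f := LinearMap.toSpanSingleton R R d ∘ₗ q)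
    (g := LinearMap.toSpanSingleton R R w ∘ₗ I.subtype) hi h) j

end Ore

section Hereditary

variable {R : Type u} [Ring R]

variable (R) in
/-- A ring is left hereditary if all its left ideals are projective. -/
def IsLeftHereditary : Prop :=
  ∀ I : Ideal R, Module.Projective R I

theorem IsLeftHereditary.of_ringEquiv {S : Type w} [Ring S] (e : R ≃+* S)
    (hR : IsLeftHereditary R) : IsLeftHereditary S := fun J => by
  have := RingHomInvPair.of_ringEquiv e
  have := RingHomInvPair.symm (e : R →+* S) (e.symm : S →+* R)
  have := hR (J.comap (e : R →+* S))
  let equiv : J.comap (e : R →+* S) ≃ₛₗ[(e : R →+* S)] J :=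
    { toFun := fun a => ⟨e a, a.2⟩
      invFun := fun b => ⟨e.symm b, by
        rw [Ideal.mem_comap]
        simp⟩
      map_add' := fun a b => Subtype.ext (map_add e _ _)
      map_smul' := fun r a => Subtype.ext (map_mul e _ _)
      left_inv := fun a => Subtype.ext (e.symm_apply_apply _)
      right_inv := fun b => Subtype.ext (e.apply_symm_apply _) }
  exact Module.Projective.of_equiv equiv

theorem exists_dual_basis {P : Type v} [AddCommGroup P] [Module R P] [Module.Finite R P]
    [Module.Projective R P] :
    ∃ (n : ℕ) (q : Fin n → P →ₗ[R] R) (c : Fin n → P), ∀ x, ∑ j, q j x • c j = x := by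
  obtain ⟨n, f, hf⟩ := Module.Finite.exists_fin' R P
  obtain ⟨s, hs⟩ := Module.projective_lifting_property f LinearMap.id hf
  refine ⟨n, fun j => LinearMap.proj j ∘ₗ s, fun j => f (Pi.single j 1), fun x => ?_⟩
  have section_apply : f (s x) = x := LinearMap.congr_fun hs x
  conv_rhs => rw [← section_apply, pi_eq_sum_univ' (s x), map_sum]
  refine Finset.sum_congr rfl fun j _ => ?_
  rw [map_smul]
  congr 2

/-- If `q j`, `c j` is a dual basis of `I` and `q' j` extends `q j`, then `∑ j, q' j x * c j = x`
holds on `I`, hence on `J`. -/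
theorem le_of_forall_exists_extension [IsDomain R] [StrongRankCondition R] {I J : Ideal R}
    [Module.Finite R I] [Module.Projective R I] (hI : I ≠ ⊥) (hIJ : I ≤ J)
    (h : ∀ q : I →ₗ[R] R, ∃ q' : J →ₗ[R] R, q' ∘ₗ Submodule.inclusion hIJ = q) : J ≤ I := by
  obtain ⟨n, q, c, hqc⟩ := exists_dual_basis (R := R) (P := I)
  choose q' hq' using fun j => h (q j)
  obtain ⟨i, hi, hi0⟩ := (Submodule.ne_bot_iff I).1 hI
  have agree : ∑ j, LinearMap.toSpanSingleton R R (c j : R) ∘ₗ q' j = J.subtype := by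
    refine linearMap_eq_of_apply_eq (i := ⟨i, hIJ hi⟩) (by simpa using hi0) ?_
    have q'_apply (j : Fin n) : q' j ⟨i, hIJ hi⟩ = q j ⟨i, hi⟩ :=
      LinearMap.congr_fun (hq' j) ⟨i, hi⟩
    simpa [q'_apply] using congrArg Subtype.val (hqc ⟨i, hi⟩)
  intro x hx
  have expand : ∑ j, q' j ⟨x, hx⟩ * (c j : R) = x := by
    simpa using LinearMap.congr_fun agree ⟨x, hx⟩
  exact expand ▸ I.sum_mem fun j _ => I.mul_mem_left _ (c j).2

/-- For a left ideal `I` containing `r`, the right ideal of all `q r` with `q : I →ₗ[R] R`. If `I`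
is regarded as a fractional ideal of a domain, this is the right ideal `r I⁻¹`. -/
def dualValues (r : R) (I : Set.Ici (Ideal.span {r})) : Submodule Rᵐᵒᵖ R :=
  LinearMap.range
    (LinearMap.applyₗ' Rᵐᵒᵖ (⟨r, I.2 (Ideal.mem_span_singleton_self r)⟩ : I.1) :
      (I.1 →ₗ[R] R) →ₗ[Rᵐᵒᵖ] R)

theorem strictAnti_dualValues [IsDomain R] [IsNoetherianRing R] (hR : IsLeftHereditary R) {r : R}
    (hr : r ≠ 0) : StrictAnti (dualValues r) := by
  intro I J hIJ
  have hrI : r ∈ I.1 := I.2 (Ideal.mem_span_singleton_self r)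
  have anti : dualValues r J ≤ dualValues r I := by
    rintro _ ⟨q, rfl⟩
    exact ⟨q ∘ₗ Submodule.inclusion hIJ.le, rfl⟩
  refine lt_of_le_not_ge anti fun hle => hIJ.not_ge ?_
  have := hR I.1
  refine le_of_forall_exists_extension (I := I.1) ((Submodule.ne_bot_iff _).2 ⟨r, hrI, hr⟩) hIJ.le
    fun q => ?_
  obtain ⟨q', hq'⟩ := hle ⟨q, rfl⟩
  exact ⟨q', linearMap_eq_of_apply_eq (i := ⟨r, hrI⟩) (by simpa using hr) hq'⟩

theorem isArtinian_quotient_span_singleton [IsDomain R] [IsNoetherianRing R]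
    [IsNoetherianRing Rᵐᵒᵖ] (hR : IsLeftHereditary R) {r : R} (hr : r ≠ 0) :
    IsArtinian R (R ⧸ Ideal.span {r}) := by
  have : IsNoetherian Rᵐᵒᵖ R :=
    isNoetherian_of_linearEquiv (MulOpposite.opLinearEquiv Rᵐᵒᵖ).symm
  have := (strictAnti_dualValues hR hr).wellFoundedLT
  exact (Submodule.comapMkQRelIso (Ideal.span {r})).strictMono.wellFoundedLT

end Hereditary

section Torsion

open scoped nonZeroDivisors

variable {R : Type u} [Ring R] {M : Type v} [AddCommGroup M] [Module R M]

theorem isArtinian_span_singleton [IsDomain R] [IsNoetherianRing R] [IsNoetherianRing Rᵐᵒᵖ]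
    (hR : IsLeftHereditary R) {r : R} (hr : r ≠ 0) {x : M} (hrx : r • x = 0) :
    IsArtinian R (Submodule.span R {x}) := by
  have := isArtinian_quotient_span_singleton hR hr
  have hle : Ideal.span {r} ≤ LinearMap.ker (LinearMap.toSpanSingleton R M x) := by
    simpa [Ideal.span_le] using hrx
  rw [← LinearMap.range_toSpanSingleton,
    ← Submodule.range_liftQ (Ideal.span {r}) (LinearMap.toSpanSingleton R M x) hle]
  infer_instance

theorem isArtinian_of_isTorsion [IsDomain R] [IsNoetherianRing R] [IsNoetherianRing Rᵐᵒᵖ]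
    (hR : IsLeftHereditary R) [Module.Finite R M] (hM : Module.IsTorsion R M) :
    IsArtinian R M := by
  obtain ⟨s, hs⟩ := Module.Finite.fg_top (R := R) (M := M)
  have artinian (x : s) : IsArtinian R (Submodule.span R {(x : M)}) := by
    obtain ⟨r, hr⟩ := @hM x
    exact isArtinian_span_singleton hR (nonZeroDivisors.ne_zero r.2) hr
  have iSup_eq_top : ⨆ x : s, Submodule.span R {(x : M)} = ⊤ := by
    rw [← hs, Submodule.span_eq_iSup_of_singleton_spans, iSup_subtype]
    rfl
  have : IsArtinian R (⨆ x : s, Submodule.span R {(x : M)} : Submodule R M) := inferInstance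
  rw [iSup_eq_top] at this
  exact isArtinian_of_linearEquiv Submodule.topEquiv

theorem mem_of_forall_smul_smul_mem [IsSimpleRing R] {n : R} (hn : n ≠ 0) {W : Submodule R M}
    {x : M} (h : ∀ r : R, n • r • x ∈ W) : x ∈ W := by
  let J : TwoSidedIdeal R := TwoSidedIdeal.mk' {a | ∀ r : R, a • r • x ∈ W}
    (fun r => by simp) (fun ha hb r => by rw [add_smul]; exact W.add_mem (ha r) (hb r))
    (fun ha r => by rw [neg_smul]; exact W.neg_mem (ha r))
    (fun ha r => by rw [mul_smul]; exact W.smul_mem _ (ha r))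
    (fun {a b} ha r => by rw [mul_smul, smul_smul b]; exact ha _)
  have hnJ : n ∈ J := by simpa [J, TwoSidedIdeal.mem_mk'] using h
  have one_mem : ∀ r : R, (1 : R) • r • x ∈ W := by
    simpa [J, TwoSidedIdeal.mem_mk'] using IsSimpleRing.one_mem_of_ne_zero_mem J hn hnJ
  simpa using one_mem 1

/-- Let `W'` be maximal in `W`, and `w ∈ W` with `n • w ∉ W'`. Then `z' = z + w` works, since
`n • z' = n • w` generates `W` modulo `W'`. -/
theorem exists_span_singleton_sup_lt [IsSimpleRing R] [IsNoetherian R M] {z : M} {n : R}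
    (hn : n ≠ 0) (hnz : n • z = 0) {W : Submodule R M} (hW : W ≠ ⊥) :
    ∃ W' < W, ∃ z', Submodule.span R {z} ⊔ W ≤ Submodule.span R {z'} ⊔ W' := by
  obtain ⟨W', (hlt : W' < W), hmax⟩ := set_has_maximal_iff_noetherian.2 ‹IsNoetherian R M›
    {V | V < W} ⟨⊥, bot_lt_iff_ne_bot.2 hW⟩
  obtain ⟨w, hwW, hw⟩ : ∃ w ∈ W, n • w ∉ W' := by
    by_contra! hcon
    refine hlt.not_ge fun w hw => ?_
    exact mem_of_forall_smul_smul_mem hn fun r => hcon _ (W.smul_mem r hw)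
  have hW' : W = W' ⊔ Submodule.span R {n • w} := by
    have hle : W' ⊔ Submodule.span R {n • w} ≤ W :=
      sup_le hlt.le ((Submodule.span_singleton_le_iff_mem _ _).2 (W.smul_mem _ hwW))
    by_contra hne
    refine hmax _ (lt_of_le_of_ne hle (Ne.symm hne)) (left_lt_sup.2 ?_)
    rwa [Submodule.span_singleton_le_iff_mem]
  have mem_sup : z + w ∈ Submodule.span R {z + w} ⊔ W' :=
    Submodule.mem_sup_left (Submodule.mem_span_singleton_self _)
  have hle : W ≤ Submodule.span R {z + w} ⊔ W' := by
    rw [hW', sup_le_iff, Submodule.span_singleton_le_iff_mem]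
    exact ⟨le_sup_right, by simpa [hnz] using Submodule.smul_mem _ n mem_sup⟩
  refine ⟨W', hlt, z + w, sup_le ?_ hle⟩
  rw [Submodule.span_singleton_le_iff_mem]
  simpa using Submodule.sub_mem _ mem_sup (hle hwW)

theorem exists_span_singleton_eq_top_of_isTorsion [IsSimpleRing R] [IsNoetherian R M]
    [IsArtinian R M] (hM : Module.IsTorsion R M) : ∃ z : M, Submodule.span R {z} = ⊤ := by
  obtain ⟨W, ⟨z, hz⟩, hW⟩ := IsArtinian.set_has_minimal
    {W : Submodule R M | ∃ z, Submodule.span R {z} ⊔ W = ⊤} ⟨⊤, 0, by simp⟩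
  by_cases hbot : W = ⊥
  · exact ⟨z, by simpa [hbot] using hz⟩
  obtain ⟨n, hnz⟩ := @hM z
  obtain ⟨W', hlt, z', hle⟩ :=
    exists_span_singleton_sup_lt (nonZeroDivisors.ne_zero n.2) hnz hbot
  exact absurd hlt (hW W' ⟨z', top_le_iff.1 (hz ▸ hle)⟩)

end Torsion

section FactorThrough

variable {R : Type u} [Ring R]

theorem exists_comp_eq_of_ker_le {A B C : Type*} [AddCommGroup A] [Module R A] [AddCommGroup B]
    [Module R B] [AddCommGroup C] [Module R C] {p : A →ₗ[R] B} (hp : Function.Surjective p)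
    {h : A →ₗ[R] C} (hle : LinearMap.ker p ≤ LinearMap.ker h) : ∃ g : B →ₗ[R] C, g ∘ₗ p = h := by
  refine ⟨(LinearMap.ker p).liftQ h hle ∘ₗ (p.quotKerEquivOfSurjective hp).symm.toLinearMap, ?_⟩
  ext a
  have : (p.quotKerEquivOfSurjective hp).symm (p a) = Submodule.Quotient.mk a :=
    (LinearEquiv.symm_apply_eq _).2 rfl
  simp [this]

end FactorThrough

section Dual

open scoped nonZeroDivisors

variable {R : Type u} [Ring R]

theorem finite_dual {P : Type v} [AddCommGroup P] [Module R P] [Module.Finite R P]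
    [Module.Projective R P] : Module.Finite Rᵐᵒᵖ (P →ₗ[R] R) := by
  obtain ⟨n, q, c, hqc⟩ := exists_dual_basis (R := R) (P := P)
  refine .of_surjective (Fintype.linearCombination Rᵐᵒᵖ q)
    fun f => ⟨fun j => MulOpposite.op (f (c j)), ?_⟩
  ext x
  have expand : ∑ j, q j x * f (c j) = f x := by
    simpa only [map_sum, map_smul, smul_eq_mul] using congrArg f (hqc x)
  simpa [Fintype.linearCombination_apply] using expand

theorem isTorsion_dual_quotient [IsDomain R] [StrongRankCondition R] [StrongRankCondition Rᵐᵒᵖ]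
    (I : Ideal R) :
    Module.IsTorsion Rᵐᵒᵖ ((I →ₗ[R] R) ⧸ Submodule.span Rᵐᵒᵖ {I.subtype}) := by
  intro x
  obtain ⟨q, rfl⟩ := Submodule.Quotient.mk_surjective _ x
  obtain ⟨d, w, hd, h⟩ := exists_apply_mul_eq_mul q
  refine ⟨⟨MulOpposite.op d, mem_nonZeroDivisors_of_ne_zero (by simpa using hd)⟩, ?_⟩
  change Submodule.Quotient.mk (MulOpposite.op d • q) = 0
  rw [Submodule.Quotient.mk_eq_zero, Submodule.mem_span_singleton]
  exact ⟨MulOpposite.op w, by ext i; simpa using (h i).symm⟩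

theorem exists_dual_eq_add [IsDomain R] [IsSimpleRing R] [IsNoetherianRing R]
    [IsNoetherianRing Rᵐᵒᵖ] (hR : IsLeftHereditary Rᵐᵒᵖ) (I : Ideal R) [Module.Projective R I] :
    ∃ q' : I →ₗ[R] R, ∀ q : I →ₗ[R] R, ∃ s t : R, ∀ i : I, q i = i * s + q' i * t := by
  let H := (I →ₗ[R] R) ⧸ Submodule.span Rᵐᵒᵖ {I.subtype}
  have torsion : Module.IsTorsion Rᵐᵒᵖ H := isTorsion_dual_quotient I
  have : Module.Finite Rᵐᵒᵖ (I →ₗ[R] R) := finite_dual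
  have : IsNoetherianRing Rᵐᵒᵖᵐᵒᵖ := isNoetherianRing_of_ringEquiv R (RingEquiv.opOp R)
  have : IsArtinian Rᵐᵒᵖ H := isArtinian_of_isTorsion hR torsion
  have : IsNoetherian Rᵐᵒᵖ H := isNoetherian_of_isNoetherianRing_of_finite _ _
  obtain ⟨z, hz⟩ := exists_span_singleton_eq_top_of_isTorsion torsion
  obtain ⟨q', rfl⟩ := Submodule.Quotient.mk_surjective _ z
  refine ⟨q', fun q => ?_⟩
  obtain ⟨t, ht⟩ := Submodule.mem_span_singleton.1
    (hz ▸ Submodule.mem_top : (Submodule.Quotient.mk q : H) ∈ _)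
  rw [← Submodule.Quotient.mk_smul, eq_comm, Submodule.Quotient.eq,
    Submodule.mem_span_singleton] at ht
  obtain ⟨s, hs⟩ := ht
  refine ⟨s.unop, t.unop, fun i => ?_⟩
  simpa [eq_sub_iff_add_eq, eq_comm] using LinearMap.congr_fun hs i

/-- The conclusion says that `R ⧸ I` is a direct summand of `R ⧸ R b`: right multiplication by
`1 - a` defines a section of `R ⧸ R b → R ⧸ I`. -/
theorem exists_sub_mul_mem_span [IsDomain R] [IsSimpleRing R] [IsNoetherianRing R]
    [IsNoetherianRing Rᵐᵒᵖ] (hR : IsLeftHereditary Rᵐᵒᵖ) (I : Ideal R) [Module.Projective R I] :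
    ∃ a ∈ I, ∃ b ∈ I, ∀ i ∈ I, i - i * a ∈ Ideal.span {b} := by
  obtain ⟨n, q, c, hqc⟩ := exists_dual_basis (R := R) (P := I)
  obtain ⟨q', hq'⟩ := exists_dual_eq_add hR I
  choose s t hst using fun j => hq' (q j)
  refine ⟨∑ j, s j * c j, I.sum_mem fun j _ => I.mul_mem_left _ (c j).2,
    ∑ j, t j * c j, I.sum_mem fun j _ => I.mul_mem_left _ (c j).2, fun i hi => ?_⟩
  refine Ideal.mem_span_singleton'.2 ⟨q' ⟨i, hi⟩, eq_sub_of_add_eq' ?_⟩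
  calc i * ∑ j, s j * c j + q' ⟨i, hi⟩ * ∑ j, t j * c j
      = ∑ j, q j ⟨i, hi⟩ * c j := by
        simp only [hst, Finset.mul_sum, ← Finset.sum_add_distrib, add_mul, mul_assoc]
    _ = i := by simpa using congrArg Subtype.val (hqc ⟨i, hi⟩)

end Dual

section TorsionSplitting

open scoped nonZeroDivisors

variable {R : Type u} [Ring R] {F : Type v} [AddCommGroup F] [Module R F]

/-- On the left ideal `J` of all `s` with `s • x ∈ N`, the map `s ↦ f (s • x)` becomes right
multiplication by some `w` after multiplication by some `d ≠ 0`, so `f · d` extends by `x ↦ w`. -/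
theorem exists_extension_mul [IsDomain R] [StrongRankCondition R] [StrongRankCondition Rᵐᵒᵖ]
    {N : Submodule R F} (f : N →ₗ[R] R) (x : F) :
    ∃ d : R, d ≠ 0 ∧ ∃ g : (N ⊔ Submodule.span R {x} : Submodule R F) →ₗ[R] R,
      ∀ n : N, g (Submodule.inclusion le_sup_left n) = f n * d := by
  have hx : x ∈ N ⊔ Submodule.span R {x} :=
    Submodule.mem_sup_right (Submodule.mem_span_singleton_self _)
  let J : Ideal R := N.comap (LinearMap.toSpanSingleton R F x)
  obtain ⟨d, w, hd, hdw⟩ := exists_apply_mul_eq_mul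
    (f ∘ₗ (LinearMap.toSpanSingleton R F x).restrict (p := J) (q := N) fun _ h => h)
  refine ⟨d, hd, ?_⟩
  let p : N × R →ₗ[R] (N ⊔ Submodule.span R {x} : Submodule R F) :=
    (Submodule.inclusion le_sup_left).coprod (LinearMap.toSpanSingleton R _ ⟨x, hx⟩)
  let h : N × R →ₗ[R] R :=
    (LinearMap.toSpanSingleton R R d ∘ₗ f).coprod (LinearMap.toSpanSingleton R R w)
  have p_surjective : Function.Surjective p := by
    rintro ⟨m, hm⟩
    obtain ⟨n, hn, s, hs, rfl⟩ := Submodule.mem_sup.1 hm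
    obtain ⟨r, rfl⟩ := Submodule.mem_span_singleton.1 hs
    exact ⟨(⟨n, hn⟩, r), Subtype.ext (by simp [p])⟩
  have ker_le : LinearMap.ker p ≤ LinearMap.ker h := by
    rintro ⟨n, r⟩ hnr
    have relation : r • x = ((-n : N) : F) := by
      simpa [p, add_eq_zero_iff_neg_eq, eq_comm] using congrArg Subtype.val hnr
    have hr : r • x ∈ N := relation ▸ (-n).2
    have hfn : f ⟨r • x, hr⟩ = -f n := by rw [← map_neg]; exact congrArg f (Subtype.ext relation)
    have : f ⟨r • x, hr⟩ * d = r * w := hdw ⟨r, hr⟩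
    simp [h, ← this, hfn]
  obtain ⟨g, hg⟩ := exists_comp_eq_of_ker_le p_surjective ker_le
  refine ⟨g, fun n => ?_⟩
  simpa [p, h] using LinearMap.congr_fun hg (n, 0)

theorem exists_dual_ne_zero [IsDomain R] [StrongRankCondition R] [StrongRankCondition Rᵐᵒᵖ]
    [IsNoetherian R F] {y : F} (hy : ∀ r : R, r • y = 0 → r = 0) : ∃ g : F →ₗ[R] R, g y ≠ 0 := by
  let ι := LinearMap.toSpanSingleton R F y
  have ι_injective : Function.Injective ι := (injective_iff_map_eq_zero ι).2 hy
  obtain ⟨N, ⟨hyN, f, hf⟩, hmax⟩ := set_has_maximal_iff_noetherian.2 ‹IsNoetherian R F›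
    {N | ∃ (hyN : y ∈ N) (f : N →ₗ[R] R), f ⟨y, hyN⟩ ≠ 0} ⟨LinearMap.range ι, ⟨1, by simp [ι]⟩,
      (LinearEquiv.ofInjective ι ι_injective).symm.toLinearMap, fun h => by
        have y_eq_zero : y = 0 := congrArg Subtype.val ((LinearEquiv.map_eq_zero_iff _).1 h)
        exact one_ne_zero (hy 1 (by rw [y_eq_zero, smul_zero]))⟩
  have mem_N (x : F) : x ∈ N := by
    by_contra hx
    obtain ⟨d, hd, g, hg⟩ := exists_extension_mul f x
    refine hmax (N ⊔ Submodule.span R {x}) ⟨Submodule.mem_sup_left hyN, g, ?_⟩ ?_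
    · exact hg ⟨y, hyN⟩ ▸ mul_ne_zero hf hd
    · exact left_lt_sup.2 fun h => hx (h (Submodule.mem_span_singleton_self x))
  exact ⟨f ∘ₗ LinearMap.id.codRestrict N mem_N, hf⟩

theorem finrank_ker_lt [IsDomain R] [IsNoetherianRing R] [Module.Finite R F] {g : F →ₗ[R] R}
    (hg : g ≠ 0) : Module.finrank R (LinearMap.ker g) < Module.finrank R F := by
  have quotient_add_le := Module.finrank_quotient_add_finrank_le (LinearMap.ker g)
  rw [g.quotKerEquivRange.finrank_eq] at quotient_add_le
  have : IsNoetherian R F := isNoetherian_of_isNoetherianRing_of_finite R F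
  have : Nontrivial (LinearMap.range g) :=
    Submodule.nontrivial_iff_ne_bot.2 fun h => hg (LinearMap.range_eq_bot.1 h)
  have range_pos : 0 < Module.finrank R (LinearMap.range g) := Module.finrank_pos
  omega

theorem isTorsion_projective_quotient_of_ker (hR : IsLeftHereditary R) (g : F →ₗ[R] R)
    {K : Submodule R (LinearMap.ker g)} (hK : Module.IsTorsion R K)
    [Module.Projective R (LinearMap.ker g ⧸ K)] :
    ∃ L : Submodule R F, Module.IsTorsion R L ∧ Module.Projective R (F ⧸ L) := by
  have := hR (LinearMap.range g)
  obtain ⟨s, hs⟩ := g.rangeRestrict.exists_rightInverse_of_surjective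
    (LinearMap.range_eq_top.2 g.surjective_rangeRestrict)
  have g_section (y) : g (s y) = y := congrArg Subtype.val (LinearMap.congr_fun hs y)
  let r : F →ₗ[R] LinearMap.ker g :=
    (LinearMap.id - s ∘ₗ g.rangeRestrict).codRestrict _ fun x => by simp [g_section]
  have r_of_mem {x} (hx : g x = 0) : (r x : F) = x := by
    have : g.rangeRestrict x = 0 := Subtype.ext hx
    simp [r, this]
  have r_section (y) : r (s y) = 0 := by
    have : g.rangeRestrict (s y) = y := LinearMap.congr_fun hs y
    exact Subtype.ext (by simp [r, this])
  let π : F →ₗ[R] (LinearMap.ker g ⧸ K) × LinearMap.range g :=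
    (K.mkQ ∘ₗ r).prod g.rangeRestrict
  have π_surjective : Function.Surjective π := by
    rintro ⟨z, y⟩
    obtain ⟨x, rfl⟩ := K.mkQ_surjective z
    have hrx : r (x : F) = x := Subtype.ext (r_of_mem x.2)
    exact ⟨x + s y, Prod.ext (by simp [π, r_section, hrx]) (Subtype.ext (by simp [π, g_section]))⟩
  refine ⟨LinearMap.ker π, ?_, .of_equiv (π.quotKerEquivOfSurjective π_surjective).symm⟩
  rintro ⟨x, hx⟩
  have hx := Prod.ext_iff.1 (LinearMap.mem_ker.1 hx)
  have hgx : g x = 0 := congrArg Subtype.val hx.2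
  have hrx : r x ∈ K := (Submodule.Quotient.mk_eq_zero K).1 hx.1
  refine (@hK ⟨r x, hrx⟩).imp fun c hc => Subtype.ext ?_
  simpa [r_of_mem hgx] using congrArg (fun y : K => ((y : LinearMap.ker g) : F)) hc

theorem exists_isTorsion_projective_quotient [IsDomain R] [IsNoetherianRing R]
    [IsNoetherianRing Rᵐᵒᵖ] (hR : IsLeftHereditary R) (F : Type v) [AddCommGroup F] [Module R F]
    [Module.Finite R F] :
    ∃ K : Submodule R F, Module.IsTorsion R K ∧ Module.Projective R (F ⧸ K) := by
  induction hn : Module.finrank R F using Nat.strong_induction_on generalizing F with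
  | _ n ih =>
  subst hn
  have : IsNoetherian R F := isNoetherian_of_isNoetherianRing_of_finite R F
  by_cases! hF : ∀ y : F, ∃ r : R, r • y = 0 ∧ r ≠ 0
  · refine ⟨⊤, fun {x} => ?_, inferInstance⟩
    obtain ⟨r, hrx, hr⟩ := hF x
    exact ⟨⟨r, mem_nonZeroDivisors_of_ne_zero hr⟩, Subtype.ext hrx⟩
  obtain ⟨y, hy⟩ := hF
  obtain ⟨g, hg⟩ := exists_dual_ne_zero hy
  obtain ⟨K, hK, _⟩ := ih _ (finrank_ker_lt fun h => hg (by simp [h])) (LinearMap.ker g) rfl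
  exact isTorsion_projective_quotient_of_ker hR g hK

end TorsionSplitting

section Lifting

variable {R : Type u} [Ring R] {F : Type v} [AddCommGroup F] [Module R F] {M : Type w}
  [AddCommGroup M] [Module R M] {A : Submodule R M}

theorem IsPureSubmodule.isRDSubmodule (hA : IsPureSubmodule A) : IsRDSubmodule A := fun r a h =>
  (PPFormula.mem_eval_dvd r).1 (hA (PPFormula.dvd r) a ((PPFormula.mem_eval_dvd r).2 h))

theorem IsRDSubmodule.exists_mk_eq_smul_eq_zero (hA : IsRDSubmodule A) {b : R} {q : M ⧸ A}
    (hb : b • q = 0) : ∃ m : M, Submodule.Quotient.mk m = q ∧ b • m = 0 := by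
  obtain ⟨m, rfl⟩ := Submodule.Quotient.mk_surjective _ q
  rw [← Submodule.Quotient.mk_smul, Submodule.Quotient.mk_eq_zero] at hb
  obtain ⟨a, ha⟩ := hA b ⟨b • m, hb⟩ ⟨m, rfl⟩
  have hba : b • (a : M) = b • m := congrArg Subtype.val ha
  exact ⟨m - a, by simp, by rw [smul_sub, hba, sub_self]⟩

/-- If `F = R z` and `m` is a preimage of `f z` with `b • m = 0`, where `a`, `b` are as in
`exists_sub_mul_mem_span`, then `z ↦ (1 - a) • m` is a lift of `f`. -/
theorem IsRDSubmodule.exists_lift_of_isTorsion [IsDomain R] [IsSimpleRing R] [IsNoetherianRing R]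
    [IsNoetherianRing Rᵐᵒᵖ] (hR : IsLeftHereditary R) (hR' : IsLeftHereditary Rᵐᵒᵖ)
    [Module.Finite R F] (hF : Module.IsTorsion R F) (hA : IsRDSubmodule A) (f : F →ₗ[R] M ⧸ A) :
    ∃ s : F →ₗ[R] M, A.mkQ ∘ₗ s = f := by
  have := isArtinian_of_isTorsion hR hF
  have : IsNoetherian R F := isNoetherian_of_isNoetherianRing_of_finite R F
  obtain ⟨z, hz⟩ := exists_span_singleton_eq_top_of_isTorsion hF
  let p := LinearMap.toSpanSingleton R F z
  have p_surjective : Function.Surjective p := by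
    rw [← LinearMap.range_eq_top, LinearMap.range_toSpanSingleton, hz]
  have := hR (LinearMap.ker p)
  obtain ⟨a, ha, b, hb, hab⟩ := exists_sub_mul_mem_span hR' (LinearMap.ker p)
  have smul_eq_zero_of_mem {i : R} (hi : i ∈ LinearMap.ker p) : i • f z = 0 := by
    rw [← map_smul, show i • z = 0 from hi, map_zero]
  obtain ⟨m, hm, hbm⟩ := hA.exists_mk_eq_smul_eq_zero (smul_eq_zero_of_mem hb)
  have ker_le : LinearMap.ker p ≤ LinearMap.ker (LinearMap.toSpanSingleton R M ((1 - a) • m)) := by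
    intro i hi
    obtain ⟨c, hc⟩ := Ideal.mem_span_singleton'.1 (hab i hi)
    rw [LinearMap.mem_ker, LinearMap.toSpanSingleton_apply, smul_smul, mul_sub, mul_one, ← hc,
      mul_smul, hbm, smul_zero]
  obtain ⟨s, hs⟩ := exists_comp_eq_of_ker_le p_surjective ker_le
  refine ⟨s, (LinearMap.cancel_right p_surjective).1 (LinearMap.ext_ring ?_)⟩
  have s_apply : s z = (1 - a) • m := by simpa [p] using LinearMap.congr_fun hs 1
  simp [p, s_apply, hm, sub_smul, smul_eq_zero_of_mem ha]

theorem IsRDSubmodule.exists_lift [IsDomain R] [IsSimpleRing R] [IsNoetherianRing R]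
    [IsNoetherianRing Rᵐᵒᵖ] (hR : IsLeftHereditary R) (hR' : IsLeftHereditary Rᵐᵒᵖ)
    [Module.Finite R F] (hA : IsRDSubmodule A) (f : F →ₗ[R] M ⧸ A) :
    ∃ s : F →ₗ[R] M, A.mkQ ∘ₗ s = f := by
  obtain ⟨K, hK, _⟩ := exists_isTorsion_projective_quotient hR F
  have : IsNoetherian R F := isNoetherian_of_isNoetherianRing_of_finite R F
  obtain ⟨σ, hσ⟩ := K.mkQ.exists_rightInverse_of_surjective K.range_mkQ
  obtain ⟨t, ht⟩ := Module.projective_lifting_property A.mkQ (f ∘ₗ σ) A.mkQ_surjective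
  obtain ⟨s, hs⟩ := hA.exists_lift_of_isTorsion hR hR' hK (f ∘ₗ K.subtype)
  let r : F →ₗ[R] K := (LinearMap.id - σ ∘ₗ K.mkQ).codRestrict K fun x => by
    rw [← Submodule.Quotient.mk_eq_zero]
    simpa [sub_eq_zero] using (LinearMap.congr_fun hσ (K.mkQ x)).symm
  refine ⟨t ∘ₗ K.mkQ + s ∘ₗ r, ?_⟩
  rw [LinearMap.comp_add, ← LinearMap.comp_assoc, ← LinearMap.comp_assoc, ht, hs]
  ext x
  simp [r]

theorem isRDRing_of_isSimpleRing [IsDomain R] [IsSimpleRing R] [IsNoetherianRing R]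
    [IsNoetherianRing Rᵐᵒᵖ] (hR : IsLeftHereditary R) (hR' : IsLeftHereditary Rᵐᵒᵖ) :
    IsRDRing.{u, w} R := by
  refine fun M _ _ A => ⟨IsPureSubmodule.isRDSubmodule, fun hA φ a => ?_⟩
  rintro ⟨y, hy⟩
  let F := Submodule.span R (Set.range (A.mkQ ∘ y))
  have : Module.Finite R F := Module.Finite.span_of_finite _ (Set.finite_range _)
  obtain ⟨s, hs⟩ := hA.exists_lift hR hR' F.subtype
  let c (j) : F := ⟨A.mkQ (y j), Submodule.subset_span ⟨j, rfl⟩⟩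
  have relation (i) : ∑ j, φ.A i j • c j = 0 := by
    have hi : A.mkQ (∑ j, φ.A i j • y j) = 0 := by
      rw [hy, Submodule.mkQ_apply, Submodule.Quotient.mk_eq_zero]
      exact A.smul_mem _ a.2
    exact Subtype.ext (by simpa [c] using hi)
  have s_relation (i) : ∑ j, φ.A i j • s (c j) = 0 := by
    simp only [← map_smul, ← map_sum, relation, map_zero]
  have sub_mem (j) : y j - s (c j) ∈ A := by
    rw [← Submodule.Quotient.mk_eq_zero, Submodule.Quotient.mk_sub, sub_eq_zero]
    exact (LinearMap.congr_fun hs (c j)).symm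
  exact ⟨fun j => ⟨y j - s (c j), sub_mem j⟩, fun i => Subtype.ext <| by
    simp [smul_sub, Finset.sum_sub_distrib, hy, s_relation]⟩

end Lifting

section Schanuel

theorem projective_ker_of_projective_ker {R F₁ F₂ M : Type*} [Ring R] [AddCommGroup F₁]
    [Module R F₁] [AddCommGroup F₂] [Module R F₂] [AddCommGroup M] [Module R M]
    [Module.Projective R F₁] [Module.Projective R F₂] {p₁ : F₁ →ₗ[R] M} {p₂ : F₂ →ₗ[R] M}
    (hp₁ : Function.Surjective p₁) (hp₂ : Function.Surjective p₂)
    [Module.Projective R (LinearMap.ker p₂)] : Module.Projective R (LinearMap.ker p₁) := by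
  obtain ⟨s, hs⟩ := Module.projective_lifting_property p₂ p₁ hp₂
  obtain ⟨t, ht⟩ := Module.projective_lifting_property p₁ p₂ hp₁
  have hs' : ∀ u, p₂ (s u) = p₁ u := LinearMap.congr_fun hs
  have ht' : ∀ u, p₁ (t u) = p₂ u := LinearMap.congr_fun ht
  let α : LinearMap.ker p₁ →ₗ[R] LinearMap.ker p₂ × F₁ :=
    (LinearMap.codRestrict _ (-(s ∘ₗ (LinearMap.ker p₁).subtype)) fun z => by
      simp [hs']).prod (LinearMap.ker p₁).subtype
  let β : LinearMap.ker p₂ × F₁ →ₗ[R] LinearMap.ker p₁ :=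
    LinearMap.codRestrict _ (LinearMap.coprod (-(t ∘ₗ (LinearMap.ker p₂).subtype))
      (LinearMap.id - t ∘ₗ s)) fun y => by simp [hs', ht']
  refine Module.Projective.of_split α β (LinearMap.ext fun z => Subtype.ext ?_)
  change -t (-s z) + ((z : F₁) - t (s z)) = z
  rw [map_neg, neg_neg, add_sub_cancel]

theorem projective_range_of_retraction_ker {R F M : Type*} [Ring R] [AddCommGroup F] [Module R F]
    [AddCommGroup M] [Module R M] [Module.Projective R F] {p : F →ₗ[R] M}
    {ρ : F →ₗ[R] LinearMap.ker p} (hρ : ∀ z : LinearMap.ker p, ρ z = z) :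
    Module.Projective R (LinearMap.range p) := by
  obtain ⟨s, hs⟩ := exists_comp_eq_of_ker_le p.surjective_rangeRestrict
    (h := LinearMap.id - (LinearMap.ker p).subtype ∘ₗ ρ) fun z hz => by
      rw [LinearMap.ker_rangeRestrict] at hz
      simpa [sub_eq_zero] using (congrArg Subtype.val (hρ ⟨z, hz⟩)).symm
  refine Module.Projective.of_split s p.rangeRestrict (LinearMap.ext fun y => ?_)
  obtain ⟨x, rfl⟩ := p.surjective_rangeRestrict y
  rw [LinearMap.comp_apply, ← LinearMap.comp_apply s, hs]
  ext
  simp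

end Schanuel

section LocallyPrincipal

/-- The image of the nonzero elements of `A` under `P : A →+* R` is a left and right Ore set, and
the localization of `R` at it is a left principal ideal ring. The second property is expressed
inside `R`: up to a left denominator in `P A`, every left ideal is generated by one element. -/
structure IsLocallyPrincipal {A R : Type*} [CommRing A] [Ring R] (P : A →+* R) : Prop where
  injective : Function.Injective P
  left_ore : ∀ (r : R) {p : A}, p ≠ 0 → ∃ p' r', p' ≠ 0 ∧ P p' * r = r' * P p
  right_ore : ∀ (r : R) {p : A}, p ≠ 0 → ∃ p' r', p' ≠ 0 ∧ r * P p' = P p * r'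
  exists_generator : ∀ I : Ideal R, I ≠ ⊥ →
    ∃ g ∈ I, g ≠ 0 ∧ ∀ a ∈ I, ∃ p, p ≠ 0 ∧ P p * a ∈ Ideal.span {g}

namespace IsLocallyPrincipal

variable {A B R : Type*} [CommRing A] [CommRing B] [Ring R] {P : A →+* R} {Q : B →+* R}

theorem ringEquiv_comp {R' : Type*} [Ring R'] (hP : IsLocallyPrincipal P) (e : R ≃+* R') :
    IsLocallyPrincipal ((e : R →+* R').comp P) where
  injective := e.injective.comp hP.injective
  left_ore r p hp := by
    obtain ⟨p', r', h, h'⟩ := hP.left_ore (e.symm r) hp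
    exact ⟨p', e r', h, by simpa using congrArg e h'⟩
  right_ore r p hp := by
    obtain ⟨p', r', h, h'⟩ := hP.right_ore (e.symm r) hp
    exact ⟨p', e r', h, by simpa using congrArg e h'⟩
  exists_generator I hI := by
    have mem_comap (a : R') (ha : a ∈ I) : e.symm a ∈ I.comap (e : R →+* R') := by
      rw [Ideal.mem_comap]
      simpa using ha
    obtain ⟨i, hi, hi0⟩ := (Submodule.ne_bot_iff I).1 hI
    have comap_ne_bot : I.comap (e : R →+* R') ≠ ⊥ :=
      (Submodule.ne_bot_iff _).2 ⟨e.symm i, mem_comap i hi, by simpa using hi0⟩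
    obtain ⟨g, hg, hg0, hgen⟩ := hP.exists_generator _ comap_ne_bot
    refine ⟨e g, hg, by simpa using hg0, fun a ha => ?_⟩
    obtain ⟨p, hp, hpa⟩ := hgen (e.symm a) (mem_comap a ha)
    obtain ⟨c, hc⟩ := Ideal.mem_span_singleton'.1 hpa
    exact ⟨p, hp, Ideal.mem_span_singleton'.2 ⟨e c, by simpa using congrArg e hc⟩⟩

theorem exists_eq_span_pair (hP : IsLocallyPrincipal P) (hQ : IsLocallyPrincipal Q)
    (hPQ : ∀ p q, p ≠ 0 → q ≠ 0 → ∃ u v, u * P p + v * Q q = 1) (I : Ideal R) :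
    ∃ g h, I = Ideal.span {g, h} := by
  by_cases hI : I = ⊥
  · exact ⟨0, 0, by simpa using hI⟩
  obtain ⟨g, hgI, -, hg⟩ := hP.exists_generator I hI
  obtain ⟨h, hhI, -, hh⟩ := hQ.exists_generator I hI
  refine ⟨g, h, le_antisymm (fun a ha => ?_) (Ideal.span_le.2 ?_)⟩
  · obtain ⟨p, hp, hpa⟩ := hg a ha
    obtain ⟨q, hq, hqa⟩ := hh a ha
    obtain ⟨u, v, huv⟩ := hPQ p q hp hq
    rw [← one_mul a, ← huv, add_mul, mul_assoc, mul_assoc]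
    exact add_mem (Ideal.mul_mem_left _ _ (Ideal.span_mono (by simp) hpa))
      (Ideal.mul_mem_left _ _ (Ideal.span_mono (by simp) hqa))
  · rintro a (rfl | rfl) <;> assumption

theorem isNoetherianRing (hP : IsLocallyPrincipal P) (hQ : IsLocallyPrincipal Q)
    (hPQ : ∀ p q, p ≠ 0 → q ≠ 0 → ∃ u v, u * P p + v * Q q = 1) : IsNoetherianRing R where
  noetherian I := by
    obtain ⟨g, h, rfl⟩ := hP.exists_eq_span_pair hQ hPQ I
    exact Submodule.fg_span (Set.toFinite _)

section CommonDenominator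

variable {ι : Type*} [Finite ι] [IsDomain A]

theorem exists_common_left_ore (hP : IsLocallyPrincipal P) (z : ι → R) {p : A} (hp : p ≠ 0) :
    ∃ (q : A) (t : ι → R), q ≠ 0 ∧ ∀ j, P q * z j = t j * P p := by
  classical
  cases nonempty_fintype ι
  choose q t hq h using fun j => hP.left_ore (z j) hp
  refine ⟨∏ j, q j, fun j => P (∏ i ∈ Finset.univ.erase j, q i) * t j,
    Finset.prod_ne_zero_iff.2 fun j _ => hq j, fun j => ?_⟩
  rw [← Finset.prod_erase_mul _ _ (Finset.mem_univ j), map_mul, mul_assoc, h, mul_assoc]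

theorem exists_common_right_ore (hP : IsLocallyPrincipal P) (z : ι → R) {p : A} (hp : p ≠ 0) :
    ∃ (q : A) (t : ι → R), q ≠ 0 ∧ ∀ j, z j * P q = P p * t j := by
  classical
  cases nonempty_fintype ι
  choose q t hq h using fun j => hP.right_ore (z j) hp
  refine ⟨∏ j, q j, fun j => t j * P (∏ i ∈ Finset.univ.erase j, q i),
    Finset.prod_ne_zero_iff.2 fun j _ => hq j, fun j => ?_⟩
  rw [← Finset.mul_prod_erase _ _ (Finset.mem_univ j), map_mul, ← mul_assoc, h, mul_assoc]

theorem exists_common_generator (hP : IsLocallyPrincipal P) {I : Ideal R} (hI : I ≠ ⊥)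
    {a : ι → R} (ha : ∀ j, a j ∈ I) :
    ∃ g ∈ I, g ≠ 0 ∧ ∃ (c : A) (r : ι → R), c ≠ 0 ∧ ∀ j, P c * a j = r j * g := by
  classical
  cases nonempty_fintype ι
  obtain ⟨g, hgI, hg0, hg⟩ := hP.exists_generator I hI
  choose c hc h using fun j => hg (a j) (ha j)
  choose r hr using fun j => Ideal.mem_span_singleton'.1 (h j)
  refine ⟨g, hgI, hg0, ∏ j, c j, fun j => P (∏ i ∈ Finset.univ.erase j, c i) * r j,
    Finset.prod_ne_zero_iff.2 fun j _ => hc j, fun j => ?_⟩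
  rw [← Finset.prod_erase_mul _ _ (Finset.mem_univ j), map_mul, mul_assoc, mul_assoc, hr]

end CommonDenominator

section Gluing

variable {ι : Type*} [IsDomain R] {p : (ι → R) →ₗ[R] R}

/-- After localization the image of `p` is free on one element, so the kernel of `p` is a direct
summand; the `z j` are the images, multiplied by `P c`, of the standard basis under a projection. -/
theorem exists_generators_ker [Fintype ι] [IsDomain A] (hP : IsLocallyPrincipal P)
    (hp : LinearMap.range p ≠ ⊥) :
    ∃ (c : A) (z : ι → LinearMap.ker p), c ≠ 0 ∧ ∀ y : LinearMap.ker p, ∃ (q : A) (v : ι → R),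
      q ≠ 0 ∧ (∀ j, P q * (y : ι → R) j = v j * P c) ∧ P q • y = ∑ j, v j • z j := by
  classical
  obtain ⟨_, ⟨γ, rfl⟩, hγ, c, r, hc, hr⟩ := hP.exists_common_generator hp
    (a := fun j => p (Pi.single j 1)) fun j => LinearMap.mem_range_self p _
  let z (j : ι) : LinearMap.ker p := ⟨P c • Pi.single j 1 - r j • γ, by
    rw [LinearMap.mem_ker, map_sub, map_smul, map_smul, smul_eq_mul, smul_eq_mul, hr, sub_self]⟩
  refine ⟨c, z, hc, fun y => ?_⟩
  obtain ⟨q, v, hq, hv⟩ := hP.exists_common_left_ore (y : ι → R) hc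
  have hy : P q • (y : ι → R) = ∑ j, v j • P c • Pi.single j (1 : R) := by
    ext i
    simp [Finset.sum_apply, Pi.single_apply, hv]
  have hz : ∑ j, v j • (z j : ι → R) = P q • (y : ι → R) - (∑ j, v j * r j) • γ := by
    simp only [z, hy, smul_sub, Finset.sum_sub_distrib, Finset.sum_smul, mul_smul]
  have hvr : ∑ j, v j * r j = 0 := by
    have := congrArg p hz
    simp only [map_sum, map_sub, map_smul, LinearMap.map_coe_ker, smul_zero,
      Finset.sum_const_zero, zero_sub, zero_eq_neg] at this
    exact (smul_eq_zero.1 this).resolve_right hγ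
  refine ⟨q, v, hq, hv, Subtype.ext ?_⟩
  simpa [hvr] using hz.symm

theorem exists_extension_mul [Finite ι] [IsDomain A] (hP : IsLocallyPrincipal P)
    (hp : LinearMap.range p ≠ ⊥) (φ : LinearMap.ker p →ₗ[R] R) :
    ∃ (s : A) (ψ : (ι → R) →ₗ[R] R), s ≠ 0 ∧ ∀ y : LinearMap.ker p, ψ y = φ y * P s := by
  cases nonempty_fintype ι
  obtain ⟨c, z, hc, hz⟩ := hP.exists_generators_ker hp
  obtain ⟨s, t, hs, ht⟩ := hP.exists_common_right_ore (fun j => φ (z j)) hc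
  refine ⟨s, Fintype.linearCombination R t, hs, fun y => ?_⟩
  obtain ⟨q, v, hq, hv, hqy⟩ := hz y
  refine mul_left_cancel₀ ((map_ne_zero_iff P hP.injective).2 hq) ?_
  calc P q * Fintype.linearCombination R t y
    _ = ∑ j, v j * (φ (z j) * P s) := by
      simp only [Fintype.linearCombination_apply, smul_eq_mul, Finset.mul_sum, ← mul_assoc, hv]
      simp only [mul_assoc, ht]
    _ = φ (P q • y) * P s := by
      simp only [hqy, map_sum, map_smul, smul_eq_mul, Finset.sum_mul, mul_assoc]
    _ = P q * (φ y * P s) := by rw [map_smul, smul_eq_mul, mul_assoc]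

theorem exists_extension [Finite ι] [IsDomain A] [IsDomain B]
    (hP : IsLocallyPrincipal P) (hQ : IsLocallyPrincipal Q)
    (hPQ : ∀ p q, p ≠ 0 → q ≠ 0 → ∃ u v, P p * u + Q q * v = 1)
    (hp : LinearMap.range p ≠ ⊥) (φ : LinearMap.ker p →ₗ[R] R) :
    ∃ ψ : (ι → R) →ₗ[R] R, ∀ y : LinearMap.ker p, ψ y = φ y := by
  obtain ⟨s, ψ, hs, hψ⟩ := hP.exists_extension_mul hp φ
  obtain ⟨t, χ, ht, hχ⟩ := hQ.exists_extension_mul hp φ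
  obtain ⟨u, v, huv⟩ := hPQ s t hs ht
  refine ⟨LinearMap.toSpanSingleton R R u ∘ₗ ψ + LinearMap.toSpanSingleton R R v ∘ₗ χ,
    fun y => ?_⟩
  simp only [LinearMap.add_apply, LinearMap.comp_apply, LinearMap.toSpanSingleton_apply,
    smul_eq_mul, hψ, hχ, mul_assoc]
  rw [← mul_add, huv, mul_one]

theorem projective_range [Finite ι] [IsDomain A] [IsDomain B] [IsNoetherianRing R]
    (hP : IsLocallyPrincipal P) (hQ : IsLocallyPrincipal Q)
    (hPQ : ∀ p q, p ≠ 0 → q ≠ 0 → ∃ u v, P p * u + Q q * v = 1)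
    [Module.Projective R (LinearMap.ker p)] : Module.Projective R (LinearMap.range p) := by
  by_cases hp : LinearMap.range p = ⊥
  · rw [hp]
    infer_instance
  have : Module.Finite R (LinearMap.ker p) := Module.Finite.of_fg (IsNoetherian.noetherian _)
  obtain ⟨m, q, c, hqc⟩ := exists_dual_basis (R := R) (P := LinearMap.ker p)
  choose ψ hψ using fun j => hP.exists_extension hQ hPQ hp (q j)
  exact projective_range_of_retraction_ker (ρ := ∑ j, (ψ j).smulRight (c j)) fun z => by
    simpa [LinearMap.sum_apply, hψ] using hqc z

end Gluing

end IsLocallyPrincipal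

end LocallyPrincipal

section FreeSubmodule

variable {A ι : Type*} [CommRing A]

theorem exists_mem_support_and_mem_supported_Iic [LinearOrder ι] {a : ι →₀ A} (ha : a ≠ 0) :
    ∃ i ∈ a.support, a ∈ Finsupp.supported A A (Set.Iic i) :=
  ⟨a.support.max' (Finsupp.support_nonempty_iff.2 ha), Finset.max'_mem _ _,
    (Finsupp.mem_supported A a).2 fun _ hj => Finset.le_max' _ _ hj⟩

theorem exists_apply_dvd_apply [IsPrincipalIdealRing A] (N : Submodule A (ι →₀ A)) (i : ι) :
    ∃ b ∈ N, ∀ a ∈ N, b i ∣ a i := by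
  let L : Ideal A := N.map (Finsupp.lapply i)
  obtain ⟨b, hb, hbi⟩ := Submodule.mem_map.1 (Submodule.IsPrincipal.generator_mem L)
  refine ⟨b, hb, fun a ha => ?_⟩
  change Finsupp.lapply (R := A) i b ∣ Finsupp.lapply (R := A) i a
  exact hbi ▸ (Submodule.IsPrincipal.mem_iff_generator_dvd L).1 (Submodule.mem_map_of_mem ha)

theorem linearIndependent_of_mem_supported_Iic [IsDomain A] [LinearOrder ι] {s : Set ι}
    {b : ι → ι →₀ A} (hb : ∀ i, b i ∈ Finsupp.supported A A (Set.Iic i))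
    (hb0 : ∀ i ∈ s, b i i ≠ 0) : LinearIndepOn A b s := by
  refine linearIndependent_iff.2 fun q hq => ?_
  by_contra hq0
  obtain ⟨n, hn, hqn⟩ := exists_mem_support_and_mem_supported_Iic hq0
  have apply_eq_zero := DFunLike.congr_fun hq (n : ι)
  rw [Finsupp.linearCombination_apply, Finsupp.sum, Finsupp.finsetSum_apply,
    Finset.sum_eq_single_of_mem n hn] at apply_eq_zero
  · exact mul_ne_zero (Finsupp.mem_support_iff.1 hn) (hb0 n n.2) apply_eq_zero
  · intro j hj hjn
    have hlt : j < n := lt_of_le_of_ne ((Finsupp.mem_supported A q).1 hqn hj) hjn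
    have hjn0 : b j n = 0 := Finsupp.notMem_support_iff.1 fun h =>
      hlt.not_ge ((Finsupp.mem_supported A _).1 (hb j) h)
    rw [Finsupp.smul_apply, hjn0, smul_zero]

theorem mem_span_of_apply_dvd_apply [LinearOrder ι] [WellFoundedLT ι]
    {N : Submodule A (ι →₀ A)} {b : ι → ι →₀ A}
    (hb : ∀ i, b i ∈ N ⊓ Finsupp.supported A A (Set.Iic i))
    (hdvd : ∀ i, ∀ a ∈ N ⊓ Finsupp.supported A A (Set.Iic i), b i i ∣ a i) {a : ι →₀ A}
    (ha : a ∈ N) : a ∈ Submodule.span A (b '' {i | b i i ≠ 0}) := by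
  suffices H : ∀ i, ∀ a ∈ N ⊓ Finsupp.supported A A (Set.Iic i),
      a ∈ Submodule.span A (b '' {i | b i i ≠ 0}) by
    rcases eq_or_ne a 0 with rfl | ha0
    · exact zero_mem _
    · obtain ⟨i, -, hai⟩ := exists_mem_support_and_mem_supported_Iic ha0
      exact H i a ⟨ha, hai⟩
  intro i
  induction i using WellFoundedLT.induction with
  | ind i ih =>
  have of_apply_eq_zero (a : ι →₀ A) (ha : a ∈ N ⊓ Finsupp.supported A A (Set.Iic i))
      (hai : a i = 0) : a ∈ Submodule.span A (b '' {i | b i i ≠ 0}) := by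
    rcases eq_or_ne a 0 with rfl | ha0
    · exact zero_mem _
    obtain ⟨j, hj, haj⟩ := exists_mem_support_and_mem_supported_Iic ha0
    have hji : j < i := lt_of_le_of_ne ((Finsupp.mem_supported A a).1 ha.2 hj) fun h =>
      Finsupp.mem_support_iff.1 hj (h ▸ hai)
    exact ih j hji a ⟨ha.1, haj⟩
  intro a ha
  obtain ⟨e, he⟩ := hdvd i a ha
  by_cases hbi : b i i = 0
  · exact of_apply_eq_zero a ha (by rw [he, hbi, zero_mul])
  rw [← sub_add_cancel a (e • b i)]
  refine add_mem (of_apply_eq_zero _ (sub_mem ha (Submodule.smul_mem _ e (hb i))) ?_)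
    (Submodule.smul_mem _ e (Submodule.subset_span ⟨i, hbi, rfl⟩))
  rw [Finsupp.sub_apply, Finsupp.smul_apply, he, smul_eq_mul, mul_comm, sub_self]

theorem free_submodule_finsupp [IsDomain A] [IsPrincipalIdealRing A] (N : Submodule A (ι →₀ A)) :
    Module.Free A N := by
  obtain ⟨_, _⟩ := exists_wellFoundedLT ι
  choose b hb hdvd using fun i =>
    exists_apply_dvd_apply (N ⊓ Finsupp.supported A A (Set.Iic i)) i
  have independent : LinearIndepOn A b {i | b i i ≠ 0} :=
    linearIndependent_of_mem_supported_Iic (fun i => (hb i).2) fun i hi => hi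
  have span_eq : Submodule.span A (Set.range fun i : {i | b i i ≠ 0} => b i) = N := by
    rw [← Set.image_eq_range b {i | b i i ≠ 0}]
    refine le_antisymm (Submodule.span_le.2 ?_)
      fun a ha => mem_span_of_apply_dvd_apply hb hdvd ha
    rintro _ ⟨i, -, rfl⟩
    exact (hb i).1
  exact span_eq ▸ Module.Free.of_basis (Module.Basis.span independent)

theorem free_submodule [IsDomain A] [IsPrincipalIdealRing A] {F : Type*} [AddCommGroup F]
    [Module A F] [Module.Free A F] (N : Submodule A F) : Module.Free A N :=
  have := free_submodule_finsupp (N.map (Module.Free.chooseBasis A F).repr.toLinearMap)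
  Module.Free.of_equiv ((Module.Free.chooseBasis A F).repr.submoduleMap N).symm

end FreeSubmodule

/-- The first Weyl algebra as a type synonym, so that its ring operations do not unfold to those of
a quotient of a free algebra. -/
def WeylRing (k : Type u) [Field k] : Type u := WeylAlgebra k

namespace WeylRing

open Polynomial

section Basic

variable (k : Type u) [Field k]

noncomputable instance : Ring (WeylRing k) := inferInstanceAs (Ring (WeylAlgebra k))

noncomputable instance : Algebra k (WeylRing k) := inferInstanceAs (Algebra k (WeylAlgebra k))

/-- The quotient map from the free algebra. -/
noncomputable def mk : FreeAlgebra k (Fin 2) →ₐ[k] WeylRing k :=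
  RingQuot.mkAlgHom k (WeylRel k)

/-- The generator `x` of the Weyl algebra. -/
noncomputable def x : WeylRing k := mk k (FreeAlgebra.ι k 0)

/-- The generator `∂` of the Weyl algebra. -/
noncomputable def d : WeylRing k := mk k (FreeAlgebra.ι k 1)

theorem d_mul_x : d k * x k = x k * d k + 1 := by
  have : mk k (FreeAlgebra.ι k 1 * FreeAlgebra.ι k 0) =
      mk k (FreeAlgebra.ι k 0 * FreeAlgebra.ι k 1 + 1) := RingQuot.mkAlgHom_rel k WeylRel.comm
  rwa [map_mul, map_add, map_one, map_mul] at this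

variable {k} {B : Type v} [Ring B] [Algebra k B]

/-- The universal property of the Weyl algebra: the homomorphism with `x ↦ a` and `∂ ↦ b`. -/
noncomputable def lift (a b : B) (h : b * a = a * b + 1) : WeylRing k →ₐ[k] B :=
  RingQuot.liftAlgHom (A := FreeAlgebra k (Fin 2)) k (s := WeylRel k)
    ⟨FreeAlgebra.lift k ![a, b], by
      rintro _ _ ⟨⟩
      simpa using h⟩

theorem lift_mk (a b : B) (h : b * a = a * b + 1) (r : FreeAlgebra k (Fin 2)) :
    lift a b h (mk k r) = FreeAlgebra.lift k ![a, b] r :=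
  RingQuot.liftAlgHom_mkAlgHom_apply k _ _ _

@[simp]
theorem lift_x (a b : B) (h : b * a = a * b + 1) : lift a b h (x k) = a := by
  rw [x, lift_mk]
  simp

@[simp]
theorem lift_d (a b : B) (h : b * a = a * b + 1) : lift a b h (d k) = b := by
  rw [d, lift_mk]
  simp

theorem algHom_ext {f g : WeylRing k →ₐ[k] B} (hx : f (x k) = g (x k))
    (hd : f (d k) = g (d k)) : f = g := by
  have h : f.comp (mk k) = g.comp (mk k) := by
    refine FreeAlgebra.hom_ext (funext fun i => ?_)
    fin_cases i
    · exact hx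
    · exact hd
  exact RingQuot.ringQuot_ext' k (s := WeylRel k) f g h

theorem adjoin_eq_top : Algebra.adjoin k {x k, d k} = ⊤ := by
  let A := Algebra.adjoin k {x k, d k}
  have hx : x k ∈ A := Algebra.subset_adjoin (by simp)
  have hd : d k ∈ A := Algebra.subset_adjoin (by simp)
  let f : WeylRing k →ₐ[k] A := lift ⟨x k, hx⟩ ⟨d k, hd⟩ (Subtype.ext (d_mul_x k))
  have hf : A.val.comp f = AlgHom.id k _ := algHom_ext (by simp [f]) (by simp [f])
  refine eq_top_iff.2 fun r _ => ?_
  rw [← AlgHom.id_apply (R := k) r, ← hf]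
  exact (f r).2

end Basic

variable {k : Type u} [Field k]

section PolynomialSubalgebras

/-- The polynomials in `x`. -/
noncomputable def polyX : k[X] →ₐ[k] WeylRing k := aeval (x k)

/-- The polynomials in `∂`. -/
noncomputable def polyD : k[X] →ₐ[k] WeylRing k := aeval (d k)

@[simp]
theorem polyX_X : polyX (k := k) X = x k := aeval_X _

@[simp]
theorem polyD_X : polyD (k := k) X = d k := aeval_X _

@[simp]
theorem polyX_C (c : k) : polyX (C c) = algebraMap k (WeylRing k) c := aeval_C _ _

theorem d_mul_polyX (p : k[X]) :
    d k * polyX p = polyX p * d k + polyX (derivative p) := by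
  induction p using Polynomial.induction_on' with
  | add p q hp hq => simp only [map_add, mul_add, add_mul, hp, hq]; abel
  | monomial n c =>
    induction n with
    | zero => simp [Algebra.commutes]
    | succ n ih =>
      rw [← monomial_mul_X, map_mul, derivative_mul, map_add, map_mul, map_mul, ← mul_assoc, ih,
        add_mul, mul_assoc, polyX_X, d_mul_x]
      simp only [derivative_X, map_one, mul_one, mul_add, ← mul_assoc]
      abel

/-- The Weyl algebra as a module over its subalgebra of polynomials in `x`. -/
noncomputable instance : Module k[X] (WeylRing k) := Module.compHom _ polyX.toRingHom

theorem smul_eq_polyX_mul (p : k[X]) (r : WeylRing k) : p • r = polyX p * r := rfl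

instance : IsScalarTower k[X] (WeylRing k) (WeylRing k) :=
  ⟨fun p r s => mul_assoc (polyX p) r s⟩

variable {M : Type*} [AddCommGroup M] [Module (WeylRing k) M] [Module k[X] M]
  [IsScalarTower k[X] (WeylRing k) M]

theorem polyX_smul (p : k[X]) (m : M) : polyX p • m = p • m := by
  rw [← smul_one_smul (WeylRing k) p m, smul_eq_polyX_mul, mul_one]

theorem d_smul_smul (p : k[X]) (m : M) : d k • p • m = p • d k • m + derivative p • m := by
  simp only [← polyX_smul, smul_smul, d_mul_polyX, add_smul]

theorem smul_mem_of_d_smul_mem {N : Submodule k[X] M} (hN : ∀ m ∈ N, d k • m ∈ N)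
    (r : WeylRing k) {m : M} (hm : m ∈ N) : r • m ∈ N := by
  have hr : r ∈ Algebra.adjoin k {x k, d k} := adjoin_eq_top (k := k) ▸ Algebra.mem_top
  induction hr using Algebra.adjoin_induction generalizing m with
  | mem r hr =>
    rcases hr with rfl | rfl
    · rw [← polyX_X, polyX_smul]
      exact N.smul_mem _ hm
    · exact hN m hm
  | algebraMap c =>
    rw [← polyX_C, polyX_smul]
    exact N.smul_mem _ hm
  | add r s _ _ hr hs =>
    rw [add_smul]
    exact add_mem (hr hm) (hs hm)
  | mul r s _ _ hr hs =>
    rw [mul_smul]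
    exact hr (hs hm)

end PolynomialSubalgebras

section Symbol

/-- The coefficientwise derivative on `k[x][y]`. -/
noncomputable def coeffDerivative : k[X][X] →ₗ[k] k[X][X] :=
  lsum fun i => (monomial i).restrictScalars k ∘ₗ derivative

@[simp]
theorem coeff_coeffDerivative (f : k[X][X]) (n : ℕ) :
    (coeffDerivative f).coeff n = derivative (f.coeff n) := by
  simp only [coeffDerivative, lsum_apply, Polynomial.sum, finsetSum_coeff, LinearMap.comp_apply,
    LinearMap.restrictScalars_apply, coeff_monomial, Finset.sum_ite_eq', mem_support_iff,
    ite_eq_left_iff, not_not]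
  intro h
  rw [h, derivative_zero]

/-- The action of the Weyl algebra on `k[x][y]` where `∂` acts as `y + d/dx`. -/
noncomputable def action : WeylRing k →ₐ[k] Module.End k k[X][X] :=
  lift (B := Module.End k k[X][X]) (LinearMap.mulLeft k (C X : k[X][X]))
    (LinearMap.mulLeft k (X : k[X][X]) + coeffDerivative) (by
    ext f n : 2
    cases n <;> simp [coeff_X_mul, coeff_C_mul, mul_left_comm (X : k[X][X]) (C X)] <;> ring)

theorem action_d (f : k[X][X]) : action (d k) f = X * f + coeffDerivative f := by
  simp [action]

theorem action_polyX (p : k[X]) (f : k[X][X]) : action (polyX p) f = p • f := by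
  induction p using Polynomial.induction_on' with
  | add p q hp hq => simp [add_smul, hp, hq]
  | monomial n c =>
    induction n generalizing f with
    | zero =>
      ext n : 1
      simp [Algebra.algebraMap_eq_smul_one, smul_eq_C_mul]
    | succ n ih =>
      rw [← monomial_mul_X, map_mul, map_mul, Module.End.mul_apply, ih, polyX_X, action, lift_x,
        LinearMap.mulLeft_apply, mul_smul, smul_eq_C_mul X]

/-- The sum `∑ pᵢ(x) ∂^i` with the coefficients `pᵢ` of a polynomial in `y` over `k[x]`. -/
noncomputable def ofSymbol : k[X][X] →ₗ[k[X]] WeylRing k :=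
  lsum fun i => LinearMap.toSpanSingleton k[X] _ (d k ^ i)

theorem ofSymbol_monomial (n : ℕ) (p : k[X]) : ofSymbol (monomial n p) = p • d k ^ n := by
  simp [ofSymbol]

theorem action_ofSymbol_one (f : k[X][X]) : action (ofSymbol f) 1 = f := by
  have action_d_pow_one (n : ℕ) : action (d k ^ n) 1 = X ^ n := by
    induction n with
    | zero => simp
    | succ n ih =>
      have : coeffDerivative (X ^ n : k[X][X]) = 0 := by
        ext i : 1
        rw [coeff_coeffDerivative, coeff_X_pow]
        split <;> simp
      rw [pow_succ', map_mul, Module.End.mul_apply, ih, action_d, this, add_zero, pow_succ']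
  induction f using Polynomial.induction_on' with
  | add p q hp hq => simp [hp, hq]
  | monomial n p =>
    rw [ofSymbol_monomial, smul_eq_polyX_mul, map_mul, Module.End.mul_apply, action_d_pow_one,
      action_polyX, smul_X_eq_monomial]

theorem ofSymbol_surjective : Function.Surjective (ofSymbol (k := k)) := by
  have stable : ∀ r ∈ LinearMap.range (ofSymbol (k := k)),
      d k • r ∈ LinearMap.range (ofSymbol (k := k)) := by
    rintro _ ⟨f, rfl⟩
    induction f using Polynomial.induction_on' with
    | add p q hp hq =>
      rw [map_add, smul_add]
      exact add_mem hp hq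
    | monomial n p =>
      refine ⟨monomial (n + 1) p + monomial n (derivative p), ?_⟩
      rw [map_add, ofSymbol_monomial, ofSymbol_monomial, ofSymbol_monomial, d_smul_smul, pow_succ',
        smul_eq_mul]
  intro r
  have one_mem : (1 : WeylRing k) ∈ LinearMap.range (ofSymbol (k := k)) :=
    ⟨monomial 0 1, by rw [ofSymbol_monomial, one_smul, pow_zero]⟩
  have := smul_mem_of_d_smul_mem stable r one_mem
  rwa [smul_eq_mul, mul_one] at this

/-- The normal form of an element of the Weyl algebra: `∑ pᵢ(x) ∂^i ↦ ∑ pᵢ y^i`. -/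
noncomputable def symbol : WeylRing k ≃ₗ[k[X]] k[X][X] :=
  (LinearEquiv.ofBijective (ofSymbol (k := k))
    ⟨Function.LeftInverse.injective (g := fun r => action r 1) action_ofSymbol_one,
      ofSymbol_surjective⟩).symm

theorem symbol_ofSymbol (f : k[X][X]) : symbol (ofSymbol f) = f :=
  symbol.apply_symm_apply f

theorem ofSymbol_symbol (r : WeylRing k) : ofSymbol (symbol r) = r :=
  symbol.symm_apply_apply r

theorem symbol_apply (r : WeylRing k) : symbol r = action r 1 := by
  rw [← action_ofSymbol_one (symbol r), ofSymbol_symbol]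

theorem symbol_mul (r s : WeylRing k) : symbol (r * s) = action r (symbol s) := by
  simp only [symbol_apply, map_mul, Module.End.mul_apply]

theorem symbol_polyX (p : k[X]) : symbol (polyX p) = C p := by
  rw [symbol_apply, action_polyX, smul_eq_C_mul, mul_one]

theorem symbol_d_pow (n : ℕ) : symbol (d k ^ n) = X ^ n := by
  rw [← one_smul k[X] (d k ^ n), ← ofSymbol_monomial, symbol_ofSymbol, monomial_one_right_eq_X_pow]

theorem polyX_injective : Function.Injective (polyX (k := k)) := fun p q h => by
  have := congrArg symbol h
  rwa [symbol_polyX, symbol_polyX, C_inj] at this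

end Symbol

section Degree

theorem natDegree_action_d_pow_le {f : k[X][X]} {m : ℕ} (hf : f.natDegree ≤ m) (i : ℕ) :
    (action (d k ^ i) f).natDegree ≤ i + m := by
  induction i with
  | zero => simpa using hf
  | succ i ih =>
    rw [pow_succ', map_mul, Module.End.mul_apply, action_d, natDegree_le_iff_coeff_eq_zero]
    intro N hN
    obtain ⟨N, rfl⟩ : ∃ M, N = M + 1 := ⟨N - 1, by omega⟩
    rw [coeff_add, coeff_X_mul, coeff_coeffDerivative,
      coeff_eq_zero_of_natDegree_lt (n := N) (by omega),
      coeff_eq_zero_of_natDegree_lt (by omega), derivative_zero, add_zero]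

theorem coeff_action_d_pow {f : k[X][X]} {m : ℕ} (hf : f.natDegree ≤ m) (i : ℕ) :
    (action (d k ^ i) f).coeff (i + m) = f.coeff m := by
  induction i with
  | zero => simp
  | succ i ih =>
    have hi := natDegree_action_d_pow_le hf i
    rw [pow_succ', map_mul, Module.End.mul_apply, action_d, add_right_comm, coeff_add,
      coeff_X_mul, coeff_coeffDerivative, ih,
      coeff_eq_zero_of_natDegree_lt (n := i + m + 1) (by omega), derivative_zero, add_zero]

theorem symbol_mul_eq_sum (r s : WeylRing k) : symbol (r * s) =
    ∑ i ∈ Finset.range ((symbol r).natDegree + 1),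
      (symbol r).coeff i • action (d k ^ i) (symbol s) := by
  conv_lhs => rw [symbol_mul, ← ofSymbol_symbol r, (symbol r).as_sum_range]
  simp only [map_sum, LinearMap.sum_apply, ofSymbol_monomial, smul_eq_polyX_mul, map_mul,
    Module.End.mul_apply, action_polyX]

theorem natDegree_symbol_mul_le (r s : WeylRing k) :
    (symbol (r * s)).natDegree ≤ (symbol r).natDegree + (symbol s).natDegree := by
  rw [symbol_mul_eq_sum]
  refine natDegree_sum_le_of_forall_le _ _ fun i hi => (natDegree_smul_le _ _).trans
    ((natDegree_action_d_pow_le le_rfl i).trans ?_)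
  have := Finset.mem_range.1 hi
  omega

theorem coeff_symbol_mul (r s : WeylRing k) :
    (symbol (r * s)).coeff ((symbol r).natDegree + (symbol s).natDegree) =
      (symbol r).leadingCoeff * (symbol s).leadingCoeff := by
  rw [symbol_mul_eq_sum, finsetSum_coeff, Finset.sum_range_succ, Finset.sum_eq_zero, zero_add,
    coeff_smul, coeff_action_d_pow le_rfl, smul_eq_mul, leadingCoeff, leadingCoeff]
  intro i hi
  have hlt := Finset.mem_range.1 hi
  have := natDegree_action_d_pow_le (le_refl (symbol s).natDegree) i
  rw [coeff_smul, coeff_eq_zero_of_natDegree_lt (p := action (d k ^ i) (symbol s)) (by omega),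
    smul_zero]

instance : IsDomain (WeylRing k) := by
  have : Nontrivial (WeylRing k) := (symbol (k := k)).toEquiv.nontrivial
  have : NoZeroDivisors (WeylRing k) := ⟨fun {r s} h => by
    have := coeff_symbol_mul r s
    rw [h, map_zero, coeff_zero, zero_eq_mul] at this
    simpa using this⟩
  exact NoZeroDivisors.to_isDomain _

theorem natDegree_symbol_mul {r s : WeylRing k} (hr : r ≠ 0) (hs : s ≠ 0) :
    (symbol (r * s)).natDegree = (symbol r).natDegree + (symbol s).natDegree := by
  refine natDegree_eq_of_le_of_coeff_ne_zero (natDegree_symbol_mul_le r s) ?_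
  rw [coeff_symbol_mul]
  exact mul_ne_zero (by simpa using hr) (by simpa using hs)

theorem leadingCoeff_symbol_mul (r s : WeylRing k) :
    (symbol (r * s)).leadingCoeff = (symbol r).leadingCoeff * (symbol s).leadingCoeff := by
  rcases eq_or_ne r 0 with rfl | hr
  · simp
  rcases eq_or_ne s 0 with rfl | hs
  · simp
  rw [← coeff_symbol_mul, leadingCoeff, natDegree_symbol_mul hr hs]

theorem degree_symbol_mul (r s : WeylRing k) :
    (symbol (r * s)).degree = (symbol r).degree + (symbol s).degree := by
  rcases eq_or_ne r 0 with rfl | hr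
  · simp
  rcases eq_or_ne s 0 with rfl | hs
  · simp
  rw [degree_eq_natDegree (by simp [hr, hs]), degree_eq_natDegree (by simpa using hr),
    degree_eq_natDegree (by simpa using hs), natDegree_symbol_mul hr hs, Nat.cast_add]

end Degree

end WeylRing

namespace WeylRing

open Polynomial

variable {k : Type u} [Field k]

section Symmetries

/-- The Fourier transform, the automorphism of the Weyl algebra with `x ↦ ∂` and `∂ ↦ -x`. -/
noncomputable def fourier : WeylRing k ≃ₐ[k] WeylRing k :=
  AlgEquiv.ofAlgHom (lift (d k) (-x k) (by rw [neg_mul, mul_neg, d_mul_x]; simp))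
    (lift (-d k) (x k) (by rw [neg_mul, mul_neg, d_mul_x]; simp))
    (algHom_ext (by simp) (by simp)) (algHom_ext (by simp) (by simp))

theorem fourier_polyX (p : k[X]) : fourier (polyX p) = polyD p := by
  have : (fourier (k := k)).toAlgHom.comp polyX = polyD :=
    Polynomial.algHom_ext (by simp [fourier])
  exact AlgHom.congr_fun this p

/-- The anti-automorphism of the Weyl algebra that swaps `x` and `∂`, as a homomorphism. -/
noncomputable def swapHom : WeylRing k →ₐ[k] (WeylRing k)ᵐᵒᵖ :=
  lift (MulOpposite.op (d k)) (MulOpposite.op (x k)) (by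
    rw [← MulOpposite.op_mul, ← MulOpposite.op_mul, d_mul_x, MulOpposite.op_add,
      MulOpposite.op_one])

theorem unop_swapHom_unop_swapHom (r : WeylRing k) :
    (swapHom (swapHom r).unop).unop = r := by
  have : ((AlgEquiv.opOp k (WeylRing k)).symm.toAlgHom.comp (AlgHom.op swapHom)).comp swapHom =
      AlgHom.id k (WeylRing k) :=
    algHom_ext (by simp [swapHom, AlgHom.comp_apply]) (by simp [swapHom, AlgHom.comp_apply])
  exact AlgHom.congr_fun this r

/-- The anti-automorphism of the Weyl algebra that swaps `x` and `∂`. -/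
noncomputable def swap : WeylRing k ≃+* (WeylRing k)ᵐᵒᵖ where
  toFun := swapHom
  invFun s := (swapHom s.unop).unop
  left_inv := unop_swapHom_unop_swapHom
  right_inv s := MulOpposite.unop_injective (unop_swapHom_unop_swapHom s.unop)
  map_mul' := map_mul _
  map_add' := map_add _

theorem swap_polyX (p : k[X]) : swap (polyX p) = MulOpposite.op (polyD p) := by
  change swapHom (polyX p) = _
  induction p using Polynomial.induction_on' with
  | add p q hp hq => simp only [map_add, hp, hq, MulOpposite.op_add]
  | monomial n c =>
    rw [← C_mul_X_pow_eq_monomial, map_mul, map_mul, map_pow, map_pow, map_mul, map_pow,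
      polyX_X, polyD_X, polyX_C, swapHom, lift_x, AlgHom.commutes, polyD, aeval_C,
      MulOpposite.algebraMap_apply, ← MulOpposite.op_pow, ← MulOpposite.op_mul, Algebra.commutes]

theorem swap_polyD (p : k[X]) : swap (polyD p) = MulOpposite.op (polyX p) := by
  have := congrArg (fun r => MulOpposite.op (swap.symm r)) (swap_polyX p)
  rw [RingEquiv.symm_apply_apply] at this
  exact this.symm

end Symmetries

section Ore

theorem exists_polyX_mul_eq_mul_polyX (r : WeylRing k) {p : k[X]} (hp : p ≠ 0) :
    ∃ p' r', p' ≠ 0 ∧ polyX p' * r = r' * polyX p := by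
  have hr : r ∈ Algebra.adjoin k {x k, d k} := adjoin_eq_top (k := k) ▸ Algebra.mem_top
  induction hr using Algebra.adjoin_induction generalizing p with
  | mem r hr =>
    rcases hr with rfl | rfl
    · exact ⟨p, x k, hp, by rw [← polyX_X, ← map_mul, ← map_mul, mul_comm]⟩
    · refine ⟨p * p, d k * polyX p - polyX (2 * derivative p), mul_ne_zero hp hp, ?_⟩
      rw [sub_mul, mul_assoc, ← map_mul, ← map_mul, d_mul_polyX, add_sub_assoc, ← map_sub,
        derivative_mul]
      ring_nf
      simp
  | algebraMap c => exact ⟨p, algebraMap k _ c, hp, (Algebra.commutes _ _).symm⟩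
  | add r s _ _ hr hs =>
    obtain ⟨p₁, r₁, h₁, e₁⟩ := hr hp
    obtain ⟨p₂, r₂, h₂, e₂⟩ := hs hp
    refine ⟨p₁ * p₂, polyX p₂ * r₁ + polyX p₁ * r₂, mul_ne_zero h₁ h₂, ?_⟩
    rw [mul_add, add_mul, mul_assoc, mul_assoc, ← e₁, ← e₂, ← mul_assoc, ← mul_assoc, ← map_mul,
      ← map_mul, mul_comm p₂]
  | mul r s _ _ hr hs =>
    obtain ⟨p₂, s', h₂, e₂⟩ := hs hp
    obtain ⟨p₁, r', h₁, e₁⟩ := hr h₂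
    exact ⟨p₁, r' * s', h₁, by rw [← mul_assoc, e₁, mul_assoc, e₂, mul_assoc]⟩

theorem exists_mul_polyX_eq_polyX_mul (r : WeylRing k) {p : k[X]} (hp : p ≠ 0) :
    ∃ p' r', p' ≠ 0 ∧ r * polyX p' = polyX p * r' := by
  let e := (fourier (k := k)).toRingEquiv.trans swap
  have he (q : k[X]) : e (polyX q) = MulOpposite.op (polyX q) := by
    rw [← swap_polyD, ← fourier_polyX]
    rfl
  obtain ⟨p', r', hp', h⟩ := exists_polyX_mul_eq_mul_polyX (e.symm (MulOpposite.op r)) hp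
  refine ⟨p', (e r').unop, hp', ?_⟩
  simpa [he] using congrArg (fun s => (e s).unop) h

end Ore

section LocalGenerators

theorem exists_minimal_natDegree {I : Ideal (WeylRing k)} (hI : I ≠ ⊥) :
    ∃ g ∈ I, g ≠ 0 ∧ ∀ a ∈ I, a ≠ 0 → (symbol g).natDegree ≤ (symbol a).natDegree := by
  obtain ⟨g, ⟨hg, hg0⟩, hmin⟩ := exists_minimalFor_of_wellFoundedLT
    (fun a => a ∈ I ∧ a ≠ 0) (fun a => (symbol a).natDegree) ((Submodule.ne_bot_iff I).1 hI)
  exact ⟨g, hg, hg0, fun a ha ha0 => (le_total _ _).elim id (hmin ⟨ha, ha0⟩)⟩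

theorem degree_symbol_sub_lt {a g : WeylRing k} (ha : a ≠ 0) (hg : g ≠ 0) {m : ℕ}
    (hm : (symbol a).natDegree = m + (symbol g).natDegree) :
    (symbol (polyX (symbol g).leadingCoeff * a -
      polyX (symbol a).leadingCoeff * (d k ^ m * g))).degree < (symbol a).degree := by
  have ha' : symbol a ≠ 0 := by simpa using ha
  have hg' : symbol g ≠ 0 := by simpa using hg
  have hdeg : (symbol a).degree = m + (symbol g).degree := by
    rw [degree_eq_natDegree ha', degree_eq_natDegree hg', hm, Nat.cast_add]
  have hdeg' : (symbol (polyX (symbol g).leadingCoeff * a)).degree = (symbol a).degree := by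
    rw [degree_symbol_mul, symbol_polyX, degree_C (leadingCoeff_ne_zero.2 hg'), zero_add]
  rw [map_sub, ← hdeg']
  refine degree_sub_lt_left ?_ ?_ ?_
  · rw [hdeg', degree_symbol_mul, degree_symbol_mul, symbol_polyX, symbol_d_pow, degree_X_pow,
      degree_C (leadingCoeff_ne_zero.2 ha'), zero_add, hdeg]
  · rwa [← degree_ne_bot, hdeg', degree_ne_bot]
  · rw [leadingCoeff_symbol_mul, leadingCoeff_symbol_mul, leadingCoeff_symbol_mul, symbol_polyX,
      symbol_polyX, symbol_d_pow, leadingCoeff_C, leadingCoeff_C, leadingCoeff_X_pow, one_mul,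
      mul_comm]

theorem exists_polyX_mul_mem_span {I : Ideal (WeylRing k)} {g : WeylRing k} (hg : g ∈ I)
    (hg0 : g ≠ 0) (hmin : ∀ a ∈ I, a ≠ 0 → (symbol g).natDegree ≤ (symbol a).natDegree)
    {a : WeylRing k} (ha : a ∈ I) : ∃ p : k[X], p ≠ 0 ∧ polyX p * a ∈ Ideal.span {g} := by
  induction hn : (symbol a).degree using WellFoundedLT.induction generalizing a with
  | ind n ih =>
  rcases eq_or_ne a 0 with rfl | ha0
  · exact ⟨1, one_ne_zero, by simp⟩
  obtain ⟨m, hm⟩ := Nat.exists_eq_add_of_le' (hmin a ha ha0)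
  set c := (symbol g).leadingCoeff
  set e := (symbol a).leadingCoeff
  have hc : c ≠ 0 := by simpa [c] using hg0
  obtain ⟨p, hp, hpb⟩ := ih _ (hn ▸ degree_symbol_sub_lt ha0 hg0 hm)
    (I.sub_mem (I.mul_mem_left _ ha) (I.mul_mem_left _ (I.mul_mem_left _ hg))) rfl
  refine ⟨p * c, mul_ne_zero hp hc, ?_⟩
  have : polyX (p * c) * a = polyX p * (polyX c * a - polyX e * (d k ^ m * g)) +
      polyX p * polyX e * d k ^ m * g := by
    simp only [mul_sub, map_mul, mul_assoc, sub_add_cancel]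
  rw [this]
  exact add_mem hpb (Ideal.mul_mem_left _ _ (Ideal.mem_span_singleton_self g))

theorem isLocallyPrincipal_polyX : IsLocallyPrincipal (polyX (k := k)).toRingHom where
  injective := polyX_injective
  left_ore := exists_polyX_mul_eq_mul_polyX
  right_ore := exists_mul_polyX_eq_polyX_mul
  exists_generator _ hI := by
    obtain ⟨g, hg, hg0, hmin⟩ := exists_minimal_natDegree hI
    exact ⟨g, hg, hg0, fun a ha => exists_polyX_mul_mem_span hg hg0 hmin ha⟩

theorem isLocallyPrincipal_polyD : IsLocallyPrincipal (polyD (k := k)).toRingHom := by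
  convert (isLocallyPrincipal_polyX (k := k)).ringEquiv_comp fourier.toRingEquiv using 1
  exact RingHom.ext fun p => (fourier_polyX p).symm

end LocalGenerators

section Comaximality

/-- Modulo `p(x)` and `h(∂)` the Weyl algebra is spanned over `k[x]` by the `∂ ^ j` with
`j < deg h`, and a nonzero polynomial in `x` kills these finitely many elements modulo `p(x)`. -/
theorem exists_polyX_mul_mem_span_pair {p h : k[X]} (hp : p ≠ 0) (hh : h ≠ 0) :
    ∃ f : k[X], f ≠ 0 ∧ ∀ r, polyX f * r ∈ Ideal.span {polyX p, polyD h} := by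
  let I : Ideal (WeylRing k) := Ideal.span {polyX p, polyD h}
  obtain ⟨f, t, hf, ht⟩ := isLocallyPrincipal_polyX.exists_common_left_ore
    (fun j : Fin h.natDegree => d k ^ (j : ℕ)) hp
  refine ⟨f, hf, fun r => ?_⟩
  let N : Submodule k[X] (WeylRing k) :=
    (I.restrictScalars k[X]).comap (LinearMap.lsmul k[X] (WeylRing k) f)
  have polyD_mod_mem (g : k[X]) : polyD (g % h) ∈ N := by
    rw [polyD, aeval_eq_sum_range]
    refine sum_mem fun i _ => ?_
    rw [← one_mul (d k ^ i), ← smul_mul_assoc, ← Algebra.algebraMap_eq_smul_one, ← polyX_C]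
    rcases eq_or_ne ((g % h).coeff i) 0 with hi | hi
    · simp [hi]
    have hlt : i < h.natDegree := by
      rw [← Nat.cast_lt (α := WithBot ℕ), ← degree_eq_natDegree hh]
      exact (le_degree_of_ne_zero hi).trans_lt (degree_mod_lt g hh)
    refine N.smul_mem _ ?_
    change polyX f * d k ^ i ∈ I
    rw [show polyX f * d k ^ i = t ⟨i, hlt⟩ * polyX p from ht ⟨i, hlt⟩]
    exact I.mul_mem_left _ (Ideal.subset_span (by simp))
  have polyD_mem (g : k[X]) : polyD g ∈ N := by
    rw [← EuclideanDomain.mod_add_div' g h, map_add, map_mul]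
    exact add_mem (polyD_mod_mem g)
      (I.mul_mem_left _ (I.mul_mem_left _ (Ideal.subset_span (by simp))))
  change r ∈ N
  rw [← ofSymbol_symbol r, (symbol r).as_sum_range, map_sum]
  refine sum_mem fun n _ => ?_
  rw [ofSymbol_monomial, ← polyD_X, ← map_pow]
  exact N.smul_mem _ (polyD_mem _)

variable [CharZero k]

/-- If `f(x)` kills a module then so does the commutator `[∂, f(x)] = f'(x)`. -/
theorem subsingleton_of_polyX_smul_eq_zero {M : Type*} [AddCommGroup M] [Module (WeylRing k) M]
    {f : k[X]} (hf : f ≠ 0) (h : ∀ m : M, polyX f • m = 0) : Subsingleton M := by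
  induction hn : f.natDegree using Nat.strong_induction_on generalizing f with
  | _ n ih =>
  rcases eq_or_ne f.natDegree 0 with h0 | h0
  · obtain ⟨c, rfl⟩ := natDegree_eq_zero.1 h0
    refine subsingleton_of_forall_eq 0 fun m => ?_
    have := congrArg (polyX (C c⁻¹) • ·) (h m)
    simpa [smul_smul, ← map_mul, ← C_mul, C_ne_zero.1 hf] using this
  · refine ih _ (hn ▸ natDegree_derivative_lt h0) (mt derivative_eq_zero.1 h0) (fun m => ?_) rfl
    have := congrArg (· • m) (d_mul_polyX f)
    simpa [add_smul, mul_smul, h] using this.symm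

theorem exists_mul_polyX_add_mul_polyD {p h : k[X]} (hp : p ≠ 0) (hh : h ≠ 0) :
    ∃ u v, u * polyX p + v * polyD h = 1 := by
  obtain ⟨f, hf, hfI⟩ := exists_polyX_mul_mem_span_pair hp hh
  rw [← Ideal.mem_span_pair, ← Ideal.eq_top_iff_one, ← Submodule.Quotient.subsingleton_iff]
  refine subsingleton_of_polyX_smul_eq_zero hf fun m => ?_
  obtain ⟨r, rfl⟩ := Submodule.Quotient.mk_surjective _ m
  rw [← Submodule.Quotient.mk_smul, Submodule.Quotient.mk_eq_zero]
  exact hfI r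

theorem exists_polyX_mul_add_polyD_mul {p h : k[X]} (hp : p ≠ 0) (hh : h ≠ 0) :
    ∃ u v, polyX p * u + polyD h * v = 1 := by
  obtain ⟨u, v, huv⟩ := exists_mul_polyX_add_mul_polyD hh hp
  refine ⟨(swap v).unop, (swap u).unop, ?_⟩
  simpa [swap_polyX, swap_polyD, add_comm] using congrArg (fun r => (swap r).unop) huv

end Comaximality

section Simplicity

theorem polyD_mul_x (p : k[X]) :
    polyD p * x k = x k * polyD p + polyD (derivative p) := by
  have swap_d : swap (d k) = MulOpposite.op (x k) := by rw [← polyD_X, swap_polyD, polyX_X]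
  simpa [swap_polyX, swap_d] using congrArg (fun r => (swap r).unop) (d_mul_polyX p)

theorem symbol_mul_x_sub_x_mul (r : WeylRing k) :
    symbol (r * x k - x k * r) = derivative (symbol r) := by
  obtain ⟨f, rfl⟩ := ofSymbol_surjective r
  rw [symbol_ofSymbol]
  induction f using Polynomial.induction_on' with
  | add p q hp hq => simp only [map_add, add_mul, mul_add, add_sub_add_comm, hp, hq]
  | monomial n p =>
    have hx : x k * polyX p = polyX p * x k := by
      rw [← polyX_X, ← map_mul, ← map_mul, mul_comm]
    have hn : polyD (derivative (X ^ n)) = n • d k ^ (n - 1) := by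
      rw [derivative_X_pow, map_mul, map_natCast, map_natCast, map_pow, polyD_X, nsmul_eq_mul]
    rw [ofSymbol_monomial, smul_eq_polyX_mul, ← polyD_X, ← map_pow, mul_assoc, polyD_mul_x,
      ← mul_assoc (x k), hx, mul_assoc, ← mul_sub, add_sub_cancel_left, hn, ← smul_eq_polyX_mul,
      map_smul, map_nsmul, symbol_d_pow, derivative_monomial, ← smul_X_eq_monomial, mul_smul,
      Nat.cast_smul_eq_nsmul]

variable [CharZero k]

theorem exists_polyX_mem {I : Ideal (WeylRing k)} [I.IsTwoSided] (hI : I ≠ ⊥) :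
    ∃ f : k[X], f ≠ 0 ∧ polyX f ∈ I := by
  obtain ⟨g, hg, hg0, hmin⟩ := exists_minimal_natDegree hI
  have hmem : g * x k - x k * g ∈ I := sub_mem (I.mul_mem_right _ hg) (I.mul_mem_left _ hg)
  have h0 : (symbol g).natDegree = 0 := by
    by_contra h0
    have hne : g * x k - x k * g ≠ 0 := fun h => h0 (derivative_eq_zero.1 (by
      rw [← symbol_mul_x_sub_x_mul, h, map_zero]))
    refine (hmin _ hmem hne).not_gt ?_
    rw [symbol_mul_x_sub_x_mul]
    exact natDegree_derivative_lt h0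
  obtain ⟨f, hf⟩ := natDegree_eq_zero.1 h0
  have hfg : polyX f = g := symbol.injective (by rw [symbol_polyX, hf])
  exact ⟨f, fun h => hg0 (by rw [← hfg, h, map_zero]), hfg ▸ hg⟩

instance : IsSimpleRing (WeylRing k) := by
  refine isSimpleRing_iff_isTwoSided_imp.2 ⟨inferInstance, fun I _ => ?_⟩
  refine or_iff_not_imp_left.2 fun hI => ?_
  obtain ⟨f, hf, hfI⟩ := exists_polyX_mem hI
  rw [← Submodule.Quotient.subsingleton_iff]
  refine subsingleton_of_polyX_smul_eq_zero hf fun m => ?_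
  obtain ⟨r, rfl⟩ := Submodule.Quotient.mk_surjective _ m
  rw [← Submodule.Quotient.mk_smul, Submodule.Quotient.mk_eq_zero]
  exact I.mul_mem_right _ hfI

end Simplicity

end WeylRing

namespace WeylRing

open Polynomial

variable {k : Type u} [Field k]

section Resolution

variable {ι : Type v}

/-- The inclusion of the free module over `k[x]` in the free module over the Weyl algebra. -/
noncomputable def polyFinsupp : (ι →₀ k[X]) →ₗ[k[X]] (ι →₀ WeylRing k) :=
  Finsupp.mapRange.linearMap (LinearMap.toSpanSingleton k[X] (WeylRing k) 1)

theorem polyFinsupp_apply (q : ι →₀ k[X]) (i : ι) : polyFinsupp q i = polyX (q i) := by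
  rw [polyFinsupp, Finsupp.mapRange.linearMap_apply, Finsupp.mapRange_apply,
    LinearMap.toSpanSingleton_apply, smul_eq_polyX_mul, mul_one]

theorem polyFinsupp_single (i : ι) (p : k[X]) :
    polyFinsupp (Finsupp.single i p) = p • Finsupp.single i 1 := by
  rw [polyFinsupp, Finsupp.mapRange.linearMap_apply, Finsupp.mapRange_single, Finsupp.smul_single,
    LinearMap.toSpanSingleton_apply]

variable {M : Type w} [AddCommGroup M] [Module (WeylRing k) M] [Module k[X] M]
  (b : Module.Basis ι k[X] M)

/-- The element of the free module on a `k[x]`-basis `b` of `M` that expresses the action of `∂` on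
the basis vector `b j`. -/
noncomputable def relation (j : ι) : ι →₀ WeylRing k :=
  Finsupp.single j (d k) - polyFinsupp (b.repr (d k • b j))

/-- The map between free modules with image the relations between the elements of the basis `b`. -/
noncomputable def relationMap : (ι →₀ WeylRing k) →ₗ[WeylRing k] (ι →₀ WeylRing k) :=
  Finsupp.linearCombination (WeylRing k) (relation b)

/-- In a relation `∑ tⱼ (∂ - fⱼ) = 0` with `fⱼ` free of `∂`, a coefficient of largest degree in `∂`
would have to vanish. -/
theorem relationMap_injective : Function.Injective (relationMap b) := by
  classical
  refine (injective_iff_map_eq_zero _).2 fun t ht => ?_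
  by_contra ht0
  obtain ⟨l, hl, hmax⟩ := t.support.exists_max_image (fun j => (symbol (t j)).natDegree)
    (Finsupp.support_nonempty_iff.2 ht0)
  have hsum : t l * d k = ∑ j ∈ t.support, t j * polyX (b.repr (d k • b j) l) := by
    have := DFunLike.congr_fun ht l
    simp only [relationMap, relation, Finsupp.linearCombination_apply, Finsupp.sum,
      Finsupp.finsetSum_apply, smul_sub, Finsupp.sub_apply, Finsupp.smul_apply,
      Finsupp.single_apply, polyFinsupp_apply, smul_eq_mul, Finset.sum_sub_distrib, mul_ite,
      mul_zero, Finset.sum_ite_eq', hl, if_true, Finsupp.zero_apply] at this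
    exact sub_eq_zero.1 this
  have hd : symbol (d k) = X := by simpa using symbol_d_pow (k := k) 1
  have hdeg : (symbol (t l * d k)).natDegree = (symbol (t l)).natDegree + 1 := by
    rw [natDegree_symbol_mul (Finsupp.mem_support_iff.1 hl) fun h => X_ne_zero (R := k[X]) (by
      rw [← hd, h, map_zero]), hd, natDegree_X]
  refine (Nat.lt_succ_self _).not_ge (hdeg.symm.le.trans ?_)
  rw [hsum, map_sum]
  refine natDegree_sum_le_of_forall_le _ _ fun j hj => (natDegree_symbol_mul_le _ _).trans ?_
  rw [symbol_polyX, natDegree_C, add_zero]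
  exact hmax j hj

theorem range_relationMap_sup_range_polyFinsupp :
    (LinearMap.range (relationMap b)).restrictScalars k[X] ⊔ LinearMap.range polyFinsupp = ⊤ := by
  set T := (LinearMap.range (relationMap b)).restrictScalars k[X] ⊔ LinearMap.range polyFinsupp
  have relationMap_mem (t) : relationMap b t ∈ T := Submodule.mem_sup_left ⟨t, rfl⟩
  have polyFinsupp_mem (q) : polyFinsupp q ∈ T := Submodule.mem_sup_right ⟨q, rfl⟩
  have single_mem (i : ι) : Finsupp.single i 1 ∈ T := by
    simpa [polyFinsupp_single] using polyFinsupp_mem (Finsupp.single i 1)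
  have d_smul_single_mem (i : ι) : d k • Finsupp.single i (1 : WeylRing k) ∈ T := by
    have := add_mem (relationMap_mem (Finsupp.single i 1))
      (polyFinsupp_mem (b.repr (d k • b i)))
    simpa [relationMap, relation] using this
  have d_smul_polyFinsupp_mem (q : ι →₀ k[X]) : d k • polyFinsupp q ∈ T := by
    induction q using Finsupp.induction_linear with
    | zero => simp only [map_zero, smul_zero, zero_mem]
    | add p q hp hq =>
      rw [map_add, smul_add]
      exact add_mem hp hq
    | single i p =>
      rw [polyFinsupp_single, d_smul_smul]
      exact add_mem (T.smul_mem _ (d_smul_single_mem i)) (T.smul_mem _ (single_mem i))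
  have d_smul_mem : ∀ u ∈ T, d k • u ∈ T := by
    intro u hu
    obtain ⟨_, ⟨t, rfl⟩, _, ⟨q, rfl⟩, rfl⟩ := Submodule.mem_sup.1 hu
    rw [smul_add, ← map_smul]
    exact add_mem (relationMap_mem _) (d_smul_polyFinsupp_mem q)
  refine eq_top_iff.2 fun u _ => ?_
  induction u using Finsupp.induction_linear with
  | zero => exact zero_mem T
  | add u v hu hv => exact add_mem (hu trivial) (hv trivial)
  | single i r =>
    simpa using smul_mem_of_d_smul_mem d_smul_mem r (single_mem i)

variable [IsScalarTower k[X] (WeylRing k) M]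

theorem linearCombination_polyFinsupp (q : ι →₀ k[X]) :
    Finsupp.linearCombination (WeylRing k) b (polyFinsupp q) =
      Finsupp.linearCombination k[X] b q := by
  induction q using Finsupp.induction_linear with
  | zero => simp only [map_zero]
  | add p q hp hq => simp only [map_add, hp, hq]
  | single i p =>
    rw [polyFinsupp_single, Finsupp.smul_single, Finsupp.linearCombination_single,
      Finsupp.linearCombination_single, smul_one_smul]

theorem linearCombination_relationMap (t : ι →₀ WeylRing k) :
    Finsupp.linearCombination (WeylRing k) b (relationMap b t) = 0 := by
  have : Finsupp.linearCombination (WeylRing k) b ∘ₗ relationMap b = 0 := by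
    refine Finsupp.lhom_ext' fun j => LinearMap.ext_ring ?_
    simp [relationMap, relation, linearCombination_polyFinsupp]
  exact LinearMap.congr_fun this t

theorem ker_linearCombination_basis :
    LinearMap.ker (Finsupp.linearCombination (WeylRing k) b) =
      LinearMap.range (relationMap b) := by
  refine le_antisymm (fun u hu => ?_) ?_
  · have hu' := Submodule.mem_top (R := k[X]) (x := u)
    rw [← range_relationMap_sup_range_polyFinsupp b] at hu'
    obtain ⟨_, ⟨t, rfl⟩, _, ⟨q, rfl⟩, rfl⟩ := Submodule.mem_sup.1 hu'
    rw [LinearMap.mem_ker, map_add, linearCombination_relationMap, zero_add,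
      linearCombination_polyFinsupp] at hu
    have hq : q = 0 := linearIndependent_iff.1 b.linearIndependent q hu
    rw [hq, map_zero, add_zero]
    exact ⟨t, rfl⟩
  · rintro _ ⟨t, rfl⟩
    exact linearCombination_relationMap b t

theorem projective_ker_linearCombination_basis :
    Module.Projective (WeylRing k)
      (LinearMap.ker (Finsupp.linearCombination (WeylRing k) b)) := by
  rw [ker_linearCombination_basis]
  exact Module.Projective.of_equiv (LinearEquiv.ofInjective _ (relationMap_injective b))

end Resolution

section Hereditary

instance : Module.Free k[X] (WeylRing k) := Module.Free.of_equiv symbol.symm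

variable [CharZero k]

instance : IsNoetherianRing (WeylRing k) :=
  isLocallyPrincipal_polyX.isNoetherianRing isLocallyPrincipal_polyD
    fun _ _ => exists_mul_polyX_add_mul_polyD

instance : IsNoetherianRing (WeylRing k)ᵐᵒᵖ := isNoetherianRing_of_ringEquiv _ swap

theorem isLeftHereditary : IsLeftHereditary (WeylRing k) := fun I => by
  obtain ⟨n, f, hf⟩ := Module.Finite.exists_fin' (WeylRing k) I
  have : Module.Free k[X] I := free_submodule (I.restrictScalars k[X])
  let b := Module.Free.chooseBasis k[X] I
  have hb : Function.Surjective (Finsupp.linearCombination (WeylRing k) b) := fun a =>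
    ⟨polyFinsupp (b.repr a), by
      rw [linearCombination_polyFinsupp, b.linearCombination_repr]⟩
  have := projective_ker_linearCombination_basis b
  have := projective_ker_of_projective_ker hf hb
  have hker : LinearMap.ker (I.subtype ∘ₗ f) = LinearMap.ker f :=
    LinearMap.ker_comp_of_ker_eq_bot f I.ker_subtype
  have hrange : LinearMap.range (I.subtype ∘ₗ f) = I := by
    rw [LinearMap.range_comp_of_range_eq_top _ (LinearMap.range_eq_top.2 hf), I.range_subtype]
  have : Module.Projective (WeylRing k) (LinearMap.ker (I.subtype ∘ₗ f)) := by rwa [hker]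
  rw [← hrange]
  exact isLocallyPrincipal_polyX.projective_range isLocallyPrincipal_polyD
    fun _ _ => exists_polyX_mul_add_polyD_mul

theorem isRDRing : IsRDRing.{u, w} (WeylRing k) :=
  isRDRing_of_isSimpleRing isLeftHereditary (.of_ringEquiv swap isLeftHereditary)

end Hereditary

end WeylRing

theorem mainTheorem6 :
    (∀ (R : Type u) [Ring R] [IsDomain R], IsRDRing.{u, max u v} R →
      ∀ (N : Type (max u v)) [AddCommGroup N] [Module R N], IsPureInjective R N →
        Module.Injective R (ulm R N) ∧
        (∃ Nr : Submodule R N, IsCompl (ulm R N) Nr ∧ ulm R Nr = ⊥) ∧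
        ulm R N = lastUlm R N ∧
        IsGreatest {U : Submodule R N | Module.Injective R U} (ulm R N)) ∧
    (∀ (k : Type u) [Field k] [CharZero k],
      IsDomain (WeylAlgebra k) ∧ IsRDRing.{u, max u v} (WeylAlgebra k)) := by
  refine ⟨fun R _ _ hR N _ _ hN => ?_, fun k _ _ =>
    ⟨inferInstanceAs (IsDomain (WeylRing k)), WeylRing.isRDRing (k := k)⟩⟩
  have hpure := isAbsolutelyPure_ulm hR hN
  have hinj := injective_ulm hN hpure
  exact ⟨hinj, exists_isCompl_ulm_eq_bot hinj, ulm_eq_lastUlm hpure, hinj,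
    fun U hU => (IsAbsolutelyPure.of_injective hU).le_ulm⟩
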